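/- For a function $g:(0,\infty)\to\mathbb{R}$ write $\widehat g(s)=\int_0^\infty g(x)x^{s-1}\,dx$ for its Mellin transform and $$g^\times(t)=\int_0^\infty\left\{\frac{x}{t}\right\}g(x)\,\frac{dx}{x},\qquad t>0,$$ where $\{\cdot\}$ is the fractional part; let $\chi$ be the indicator function of $(0,1)$. A sequence $(g_k)_{k\ge0}$ of real functions on $(0,\infty)$ is said to verify gNB if there are real coefficients $(c_{k,n})_{0\le k\le n}$ such that $\chi-\sum_{k=0}^n c_{k,n}g_k^\times\in L^2(0,\infty)$ for all $n$ and $$\int_0^\infty\Big|\chi(t)-\sum_{k=0}^n c_{k,n}\,g_k^\times(t)\Big|^2dt\xrightarrow[n\to\infty]{}0 .$$ **Theorem.** Let $g_0\in C^\infty((0,\infty))$ be real-valued and such that for every $k\ge0$ there is an $\alpha>0$ (which may depend on $k$) with $$\lim_{x\to0^+}x^{k-\alpha}g_0^{(k)}(x)=\lim_{x\to\infty}x^{k+1+\alpha}g_0^{(k)}(x)=0 .$$ Let $(r_k)_{k\ge0}$ be a sequence of real numbers, and define $g_{k+1}(x)=-x\,g_k'(x)-r_k\,g_k(x)$ for $x>0$,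 $k\ge0$. Then, for every $k\ge0$, the integral defining $g_k^\times(t)$ converges absolutely for every $t>0$, the integrals defining $\widehat{g_0}(s)$ and $\widehat{g_k^\times}(s)$ converge absolutely for $0<\operatorname{Re}s<1$, and $$\widehat{g_k^\times}(s)=-\prod_{j=0}^{k-1}(s-r_j)\,\frac{\zeta(s)}{s}\,\widehat{g_0}(s),\qquad 0<\operatorname{Re}s<1$$ (the empty product, for $k=0$, is $1$). If, moreover, $g_0$ is not identically zero and there are $\delta>0$ and $C$ with $\big|\widehat{g_0}\big(\tfrac12+it\big)\big|\le C e^{-\delta|t|}$ for all $t\in\mathbb{R}$, then $(g_k)_{k\ge0}$ verifies gNB. -/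

import Mathlib

open Set Filter MeasureTheory
open scoped Topology ContDiff

/-- The integrand of the multiplicative convolution of `g` with the fractional part,
`x ↦ {x / t} g(x) / x`. -/
noncomputable def fractConvIntegrand (g : ℝ → ℝ) (t x : ℝ) : ℝ :=
  Int.fract (x / t) * g x / x

/-- The multiplicative convolution of `g` with the fractional part,
`g^×(t) = ∫_0^∞ {x / t} g(x) dx / x`. -/
noncomputable def fractConv (g : ℝ → ℝ) (t : ℝ) : ℝ :=
  ∫ x in Ioi (0 : ℝ), fractConvIntegrand g t x

/-- The indicator function `χ` of the interval `(0, 1)`. -/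
noncomputable def chi : ℝ → ℝ :=
  (Ioo (0 : ℝ) 1).indicator (fun _ => 1)

/-- The Mellin transform `∫_0^∞ g(x) x^(s-1) dx` of a real function. -/
noncomputable def realMellin (g : ℝ → ℝ) (s : ℂ) : ℂ :=
  mellin (fun x => (g x : ℂ)) s

/-- Absolute convergence of the integral that defines the Mellin transform of a real function. -/
def RealMellinConvergent (g : ℝ → ℝ) (s : ℂ) : Prop :=
  MellinConvergent (fun x => (g x : ℂ)) s

/-- The sequence `(g_k)_{k ≥ 0}` verifies gNB: there are real coefficients `c k n`, `0 ≤ k ≤ n`,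
such that the functions `χ - ∑_{k ≤ n} c k n • g_k^×` are square integrable on `(0, ∞)` and
the integrals of their squares tend to `0`. -/
def VerifiesGNB (g : ℕ → ℝ → ℝ) : Prop :=
  ∃ c : ℕ → ℕ → ℝ,
    (∀ n : ℕ, MemLp (fun t => chi t - ∑ k ∈ Finset.range (n + 1), c k n * fractConv (g k) t) 2
      (volume.restrict (Ioi (0 : ℝ)))) ∧
    Tendsto
      (fun n : ℕ => ∫ t in Ioi (0 : ℝ),
        |chi t - ∑ k ∈ Finset.range (n + 1), c k n * fractConv (g k) t| ^ 2)
      atTop (𝓝 0)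

/-! The Mellin transform on Re s = 1/2 is a Fourier transform, hence an isometry from L²(0,∞) onto
its image in L² of the line (`eLpNorm_mellin_criticalPoint`). It sends χ to 1/s. The fractional part
has transform -ζ(s)/s at -s (`mellin_complexFract`), and g^× is a multiplicative convolution, so
Fubini gives it the transform -(ζ(s)/s)ĝ(s) (`mellin_fractConv`). The operator -x d/dx - r becomes
multiplication by s - r (`mellin_eulerOperator`), whence the product formula. For gNB it suffices
that the functions P_k Z are total in L² of the critical line, where Z is the transform of g_0^× and
P_k is the monic polynomial ∏_{j<k}(s - r_j). Whatever the r_j are, the P_k span all polynomials. If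
h is orthogonal to every P_k Z, all polynomial moments of φ = Z·conj h vanish. The exponential decay
of Z makes the moment problem determinate, so φ = 0 (`ae_eq_zero_of_moments_eq_zero`). Finally Z ≠ 0
almost everywhere, since ζ has countably many zeros and ĝ_0 is holomorphic and not identically zero;
so h = 0 (`topologicalClosure_span_eq_top`). The location of the zeros of ζ plays no role. -/

/-! ### Plancherel for Fourier integrals on L¹ ∩ L² -/

open FourierTransform SchwartzMap in
/-- The `L²` Fourier transform of an integrable function is given by the Fourier integral. -/
theorem coeFn_fourier_toLp {f : ℝ → ℂ} (hf : Integrable f) (hf2 : MemLp f 2) :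
    ((𝓕 (hf2.toLp f) : Lp ℂ 2 (volume : Measure ℝ)) : ℝ → ℂ) =ᵐ[volume] 𝓕 f := by
  have hcont : Continuous (𝓕 f) :=
    VectorFourier.fourierIntegral_continuous Real.continuous_fourierChar
      (L := innerₗ ℝ) (by fun_prop) hf
  apply ae_eq_of_integral_contDiff_smul_eq
  · exact (Lp.memLp _).locallyIntegrable (by norm_num)
  · exact hcont.locallyIntegrable
  intro g hg hg'
  have hg2 : HasCompactSupport (fun x => (g x : ℂ)) := hg'.comp_left (g := ((↑) : ℝ → ℂ)) rfl
  set φ : 𝓢(ℝ, ℂ) := hg2.toSchwartzMap (Complex.ofRealCLM.contDiff.comp hg)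
  have hφ : ∀ x, φ x = (g x : ℂ) := fun x => rfl
  -- The L² transform agrees with the distributional one, so it can be moved onto the test function;
  -- the Fourier integral has the same symmetry.
  have key := DFunLike.congr_fun (Lp.fourier_toTemperedDistribution_eq (hf2.toLp f)) φ
  rw [TemperedDistribution.fourier_apply, Lp.toTemperedDistribution_apply,
    Lp.toTemperedDistribution_apply] at key
  have h1 : ∫ x, g x • (𝓕 (hf2.toLp f) : Lp ℂ 2 (volume : Measure ℝ)) x =
      ∫ x, (𝓕 φ) x • (hf2.toLp f) x := by
    rw [key]; rfl
  rw [h1]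
  have h2 : ∫ x, (𝓕 φ) x • (hf2.toLp f) x = ∫ x, (𝓕 φ) x • f x := by
    apply integral_congr_ae
    filter_upwards [hf2.coeFn_toLp] with x hx
    rw [hx]
  rw [h2]
  have h3 := VectorFourier.integral_fourierIntegral_smul_eq_flip (μ := (volume : Measure ℝ))
    (ν := (volume : Measure ℝ)) (L := innerₗ ℝ) (f := φ) (g := f)
    Real.continuous_fourierChar (by fun_prop) φ.integrable hf
  rw [flip_innerₗ] at h3
  exact h3

open FourierTransform in
theorem memLp_fourier {f : ℝ → ℂ} (hf : Integrable f) (hf2 : MemLp f 2) : MemLp (𝓕 f) 2 :=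
  (Lp.memLp _).ae_eq (coeFn_fourier_toLp hf hf2)

open FourierTransform in
/-- Plancherel's theorem for functions in `L¹ ∩ L²`. -/
theorem eLpNorm_fourier {f : ℝ → ℂ} (hf : Integrable f) (hf2 : MemLp f 2) :
    eLpNorm (𝓕 f) 2 = eLpNorm f 2 := by
  rw [← eLpNorm_congr_ae (coeFn_fourier_toLp hf hf2), ← eLpNorm_congr_ae hf2.coeFn_toLp,
    ← ENNReal.toReal_eq_toReal_iff' (Lp.eLpNorm_ne_top _) (Lp.eLpNorm_ne_top _),
    ← Lp.norm_def, ← Lp.norm_def, Lp.norm_fourier_eq]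

/-- Injectivity of the Fourier integral on `L¹ ∩ L²`. -/
theorem ae_eq_zero_of_fourier_eq_zero {f : ℝ → ℂ} (hf : Integrable f) (hf2 : MemLp f 2)
    (h : ∀ x, FourierTransform.fourier f x = 0) : f =ᵐ[volume] 0 := by
  rw [← eLpNorm_eq_zero_iff hf2.1 two_ne_zero, ← eLpNorm_fourier hf hf2]
  simp [funext h]

/-! ### The Mellin transform on the critical line -/

/-- The point `1/2 + 2πi t` of the critical line. -/
noncomputable def criticalPoint (t : ℝ) : ℂ := 1 / 2 + 2 * Real.pi * t * Complex.I

@[simp] theorem criticalPoint_re (t : ℝ) : (criticalPoint t).re = 1 / 2 := by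
  simp [criticalPoint]

@[simp] theorem criticalPoint_im (t : ℝ) : (criticalPoint t).im = 2 * Real.pi * t := by
  simp [criticalPoint]

theorem continuous_criticalPoint : Continuous criticalPoint := by
  unfold criticalPoint; fun_prop

/-- The function on `ℝ` whose Fourier transform is the Mellin transform on the critical line. -/
noncomputable def logPullback (f : ℝ → ℂ) (u : ℝ) : ℂ :=
  Real.exp (-(1 / 2) * u) • f (Real.exp (-u))

/-- The factor 2π in `criticalPoint` matches the normalisation of the Fourier integral, so no
rescaling of t remains. -/
theorem mellin_criticalPoint (f : ℝ → ℂ) (t : ℝ) :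
    mellin f (criticalPoint t) = FourierTransform.fourier (logPullback f) t := by
  rw [mellin_eq_fourier]
  have : (criticalPoint t).im / (2 * Real.pi) = t := by
    rw [criticalPoint_im]; field_simp
  rw [this, criticalPoint_re]
  rfl

theorem hasDerivAt_exp_neg (u : ℝ) :
    HasDerivAt (fun u => Real.exp (-u)) (-Real.exp (-u)) u := by
  simpa using (hasDerivAt_neg u).exp

theorem injective_exp_neg : Function.Injective (fun u : ℝ => Real.exp (-u)) :=
  Real.exp_injective.comp neg_injective

theorem image_exp_neg : (fun u : ℝ => Real.exp (-u)) '' univ = Ioi 0 := by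
  rw [image_univ]
  ext x
  constructor
  · rintro ⟨u, rfl⟩
    exact Real.exp_pos _
  · intro hx
    exact ⟨-Real.log x, by simpa using Real.exp_log hx⟩

theorem logPullback_integrable {f : ℝ → ℂ} (hf : MellinConvergent f (1 / 2)) :
    Integrable (logPullback f) := by
  unfold MellinConvergent at hf
  rw [← image_exp_neg, integrableOn_image_iff_integrableOn_abs_deriv_smul MeasurableSet.univ
    (fun u _ => (hasDerivAt_exp_neg u).hasDerivWithinAt) injective_exp_neg.injOn,
    integrableOn_univ] at hf
  refine hf.congr (Eventually.of_forall fun u => ?_)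
  simp only [logPullback, abs_neg, Real.abs_exp]
  rw [Complex.real_smul, Complex.real_smul, smul_eq_mul, ← mul_assoc]
  congr 1
  rw [show (1 / 2 - 1 : ℂ) = ((-(1 / 2) : ℝ) : ℂ) by push_cast; norm_num,
    ← Complex.ofReal_cpow (Real.exp_pos _).le, ← Complex.ofReal_mul, ← Real.exp_mul,
    ← Real.exp_add]
  congr 2
  ring

/-- The weight e^{-u/2} is the square root of the Jacobian of x = e^{-u}, which makes the pullback
isometric. -/
theorem lintegral_logPullback (f : ℝ → ℂ) :
    ∫⁻ u, ‖logPullback f u‖ₑ ^ (2 : ℝ) = ∫⁻ x in Ioi (0 : ℝ), ‖f x‖ₑ ^ (2 : ℝ) := by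
  rw [← image_exp_neg, lintegral_image_eq_lintegral_abs_deriv_mul MeasurableSet.univ
    (fun u _ => (hasDerivAt_exp_neg u).hasDerivWithinAt) injective_exp_neg.injOn,
    Measure.restrict_univ]
  congr 1 with u
  simp only [logPullback, abs_neg, Real.abs_exp, enorm_smul]
  rw [ENNReal.mul_rpow_of_nonneg _ _ (by norm_num), Real.enorm_of_nonneg (Real.exp_pos _).le,
    ENNReal.ofReal_rpow_of_pos (Real.exp_pos _), ← Real.exp_mul]
  congr 3
  ring

theorem eLpNorm_logPullback (f : ℝ → ℂ) :
    eLpNorm (logPullback f) 2 = eLpNorm f 2 (volume.restrict (Ioi (0 : ℝ))) := by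
  rw [eLpNorm_eq_lintegral_rpow_enorm_toReal two_ne_zero ENNReal.ofNat_ne_top,
    eLpNorm_eq_lintegral_rpow_enorm_toReal two_ne_zero ENNReal.ofNat_ne_top]
  simp only [ENNReal.toReal_ofNat, lintegral_logPullback]

theorem memLp_logPullback {f : ℝ → ℂ} (hf : MellinConvergent f (1 / 2))
    (hf2 : MemLp f 2 (volume.restrict (Ioi (0 : ℝ)))) : MemLp (logPullback f) 2 :=
  ⟨(logPullback_integrable hf).1, by rw [eLpNorm_logPullback]; exact hf2.2⟩

theorem continuous_mellin_criticalPoint {f : ℝ → ℂ} (hf : MellinConvergent f (1 / 2)) :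
    Continuous fun t => mellin f (criticalPoint t) := by
  simp only [mellin_criticalPoint]
  exact VectorFourier.fourierIntegral_continuous Real.continuous_fourierChar
      (L := innerₗ ℝ) (by fun_prop) (logPullback_integrable hf)

theorem memLp_mellin_criticalPoint {f : ℝ → ℂ} (hf : MellinConvergent f (1 / 2))
    (hf2 : MemLp f 2 (volume.restrict (Ioi (0 : ℝ)))) :
    MemLp (fun t => mellin f (criticalPoint t)) 2 := by
  simp only [mellin_criticalPoint]
  exact memLp_fourier (logPullback_integrable hf) (memLp_logPullback hf hf2)

/-- Plancherel's theorem for the Mellin transform on the critical line. -/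
theorem eLpNorm_mellin_criticalPoint {f : ℝ → ℂ} (hf : MellinConvergent f (1 / 2))
    (hf2 : MemLp f 2 (volume.restrict (Ioi (0 : ℝ)))) :
    eLpNorm (fun t => mellin f (criticalPoint t)) 2 =
      eLpNorm f 2 (volume.restrict (Ioi (0 : ℝ))) := by
  simp only [mellin_criticalPoint]
  rw [← eLpNorm_logPullback, ← eLpNorm_fourier (logPullback_integrable hf)
    (memLp_logPullback hf hf2)]

/-! ### Determinacy of moments under exponential decay -/

/-- If all the moments of `ψ` against powers of `criticalPoint` vanish and `ψ` decays
exponentially, then the moments of small exponential twists of `ψ` vanish too. -/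
theorem integral_exp_mul_pow_eq_zero_of_small {ψ : ℝ → ℂ} {c : ℝ} (hc : 0 < c)
    (hm : AEStronglyMeasurable ψ)
    (hI : Integrable fun t => Real.exp (c * ‖criticalPoint t‖) * ‖ψ t‖)
    (h : ∀ n : ℕ, ∫ t, ψ t * criticalPoint t ^ n = 0) {y : ℝ} (hy : |y| ≤ c / 2) (n : ℕ) :
    ∫ t, ψ t * Complex.exp (y * criticalPoint t) * criticalPoint t ^ n = 0 := by
  have hcσ := continuous_criticalPoint
  set σ := criticalPoint
  have hsum : ∀ t, HasSum (fun m : ℕ => ‖ψ t‖ * ‖σ t‖ ^ n * ((|y| * ‖σ t‖) ^ m / m.factorial))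
      (‖ψ t‖ * ‖σ t‖ ^ n * Real.exp (|y| * ‖σ t‖)) := by
    intro t
    apply HasSum.mul_left
    rw [Real.exp_eq_exp_ℝ]
    exact NormedSpace.expSeries_div_hasSum_exp _
  -- Expand exp(yσ) in its power series and integrate termwise; each term is a multiple of a
  -- vanishing moment.
  have key := hasSum_integral_of_dominated_convergence (μ := (volume : Measure ℝ))
    (F := fun (m : ℕ) t => ψ t * σ t ^ n * ((y * σ t) ^ m / m.factorial))
    (f := fun t => ψ t * σ t ^ n * Complex.exp (y * σ t))
    (fun m t => ‖ψ t‖ * ‖σ t‖ ^ n * ((|y| * ‖σ t‖) ^ m / m.factorial))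
    (fun m => (hm.mul (by fun_prop)).mul (by fun_prop))
    (fun m => Eventually.of_forall fun t => by simp)
    (Eventually.of_forall fun t => (hsum t).summable)
    ?_
    (Eventually.of_forall fun t => by
      apply HasSum.mul_left
      rw [Complex.exp_eq_exp_ℂ]
      exact NormedSpace.expSeries_div_hasSum_exp _)
  · have hz : ∀ m : ℕ, ∫ t, ψ t * σ t ^ n * ((y * σ t) ^ m / m.factorial) = 0 := by
      intro m
      have : ∀ t, ψ t * σ t ^ n * ((y * σ t) ^ m / m.factorial) =
          ((y : ℂ) ^ m / m.factorial) * (ψ t * σ t ^ (n + m)) := by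
        intro t; ring
      simp only [this]
      rw [integral_const_mul, h, mul_zero]
    simp only [hz] at key
    rw [← key.unique hasSum_zero]
    congr 1 with t
    ring
  · simp only [fun t => (hsum t).tsum_eq]
    refine (hI.const_mul ((n.factorial : ℝ) * (2 / c) ^ n)).mono' ?_ ?_
    · exact (hm.norm.mul (by fun_prop)).mul (by fun_prop)
    · refine Eventually.of_forall fun t => ?_
      rw [Real.norm_of_nonneg (by positivity)]
      -- Half of the available weight e^{c‖σ‖} absorbs ‖σ‖^n, the other half absorbs e^{|y|‖σ‖}.
      have h1 := Real.pow_div_factorial_le_exp (c / 2 * ‖σ t‖) (by positivity) n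
      have h2 : ‖σ t‖ ^ n ≤ n.factorial * (2 / c) ^ n * Real.exp (c / 2 * ‖σ t‖) := by
        calc ‖σ t‖ ^ n = n.factorial * (2 / c) ^ n * ((c / 2 * ‖σ t‖) ^ n / n.factorial) := by
              rw [mul_pow, div_pow, div_pow]
              field_simp
          _ ≤ _ := by gcongr
      have h3 : Real.exp (|y| * ‖σ t‖) ≤ Real.exp (c / 2 * ‖σ t‖) := by gcongr
      calc ‖ψ t‖ * ‖σ t‖ ^ n * Real.exp (|y| * ‖σ t‖)
          ≤ ‖ψ t‖ * (n.factorial * (2 / c) ^ n * Real.exp (c / 2 * ‖σ t‖)) *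
            Real.exp (c / 2 * ‖σ t‖) := by gcongr
        _ = n.factorial * (2 / c) ^ n *
            ((Real.exp (c / 2 * ‖σ t‖) * Real.exp (c / 2 * ‖σ t‖)) * ‖ψ t‖) := by ring
        _ = _ := by
            rw [← Real.exp_add]
            ring_nf

/-- Since Re σ = 1/2 is constant, a twist by exp(xσ) with x real multiplies ‖ψ‖ by a constant only.
The hypotheses thus survive each twist, and N steps of size at most c/2 reach any x. -/
theorem integral_exp_mul_pow_eq_zero {ψ : ℝ → ℂ} {c : ℝ} (hc : 0 < c)
    (hm : AEStronglyMeasurable ψ)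
    (hI : Integrable fun t => Real.exp (c * ‖criticalPoint t‖) * ‖ψ t‖)
    (h : ∀ n : ℕ, ∫ t, ψ t * criticalPoint t ^ n = 0) (x : ℝ) (n : ℕ) :
    ∫ t, ψ t * Complex.exp (x * criticalPoint t) * criticalPoint t ^ n = 0 := by
  have hcσ := continuous_criticalPoint
  obtain ⟨N, hN⟩ := exists_nat_gt (|x| / (c / 2))
  have hN0 : (0 : ℝ) < N := lt_of_le_of_lt (by positivity) hN
  set y := x / N with hy
  have hyc : |y| ≤ c / 2 := by
    rw [hy, abs_div, Nat.abs_cast, div_le_iff₀ hN0]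
    rw [div_lt_iff₀ (by positivity)] at hN
    linarith
  have step : ∀ M : ℕ, ∀ n : ℕ,
      ∫ t, ψ t * Complex.exp ((M * y : ℝ) * criticalPoint t) * criticalPoint t ^ n = 0 := by
    intro M
    induction M with
    | zero => intro n; simpa using h n
    | succ M ih =>
      intro n
      have hm' : AEStronglyMeasurable
          fun t => ψ t * Complex.exp ((M * y : ℝ) * criticalPoint t) :=
        hm.mul (by fun_prop)
      have := integral_exp_mul_pow_eq_zero_of_small hc hm' ?_ ih hyc n
      · rw [← this]
        congr 1 with t
        rw [mul_assoc (ψ t) (Complex.exp _) (Complex.exp _), ← Complex.exp_add]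
        push_cast
        ring_nf
      · convert hI.mul_const (Real.exp (M * y * (1 / 2))) using 2 with t
        rw [norm_mul, Complex.norm_exp, Complex.re_ofReal_mul, criticalPoint_re]
        ring
  have := step N n
  rwa [show (N : ℝ) * y = x by rw [hy]; field_simp] at this

/-- Determinacy: a function with exponential decay all of whose moments vanish is zero. -/
theorem ae_eq_zero_of_moments_eq_zero {φ : ℝ → ℂ} {c : ℝ} (hc : 0 < c)
    (hI : Integrable fun t => Real.exp (c * ‖criticalPoint t‖) * ‖φ t‖)
    (hφ : Integrable φ) (hφ2 : MemLp φ 2)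
    (h : ∀ n : ℕ, ∫ t, φ t * criticalPoint t ^ n = 0) : φ =ᵐ[volume] 0 := by
  refine ae_eq_zero_of_fourier_eq_zero hφ hφ2 fun x => ?_
  rw [Real.fourier_eq']
  -- As σ = 1/2 + 2πit, the character e^{-2πitx} equals e^{x/2} exp(-xσ).
  have := integral_exp_mul_pow_eq_zero hc hφ.1 hI h (-x) 0
  have h2 : ∀ t : ℝ, Complex.exp (((-2 * Real.pi * inner ℝ t x : ℝ) : ℂ) * Complex.I) • φ t =
      Complex.exp (x / 2) *
        (φ t * Complex.exp ((-x : ℝ) * criticalPoint t) * criticalPoint t ^ 0) := by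
    intro t
    rw [pow_zero, mul_one, mul_left_comm, ← Complex.exp_add, smul_eq_mul, mul_comm]
    congr 2
    simp only [criticalPoint, RCLike.inner_apply, conj_trivial]
    push_cast
    ring
  simp only [h2]
  rw [integral_const_mul, this, mul_zero]

theorem integrable_exp_neg_mul_abs {b : ℝ} (hb : 0 < b) :
    Integrable fun t : ℝ => Real.exp (-b * |t|) := by
  rw [← integrableOn_univ, ← Iic_union_Ioi (a := (0 : ℝ))]
  refine IntegrableOn.union ?_ ?_
  · refine (integrableOn_exp_mul_Iic hb 0).congr_fun (fun x hx => ?_) measurableSet_Iic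
    simp [abs_of_nonpos (mem_Iic.1 hx)]
  · refine (integrableOn_exp_mul_Ioi (neg_lt_zero.2 hb) 0).congr_fun (fun x hx => ?_)
      measurableSet_Ioi
    simp [abs_of_pos (mem_Ioi.1 hx)]

theorem norm_criticalPoint_le (t : ℝ) : ‖criticalPoint t‖ ≤ 1 / 2 + 2 * Real.pi * |t| := by
  unfold criticalPoint
  refine (norm_add_le _ _).trans ?_
  simp [abs_of_pos Real.pi_pos]

/-! ### Density on the critical line -/

/-- The functions `∏_{j < k} (s - r_j) Z(s)` on the critical line span a dense subspace of `L²`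
when `Z` decays exponentially and vanishes almost nowhere. -/
theorem topologicalClosure_span_eq_top {Z : ℝ → ℂ} {C b : ℝ} (hb : 0 < b)
    (hZc : Continuous Z) (hZ : ∀ t, ‖Z t‖ ≤ C * Real.exp (-b * |t|)) (hZ0 : ∀ᵐ t, Z t ≠ 0)
    (r : ℕ → ℝ) (U : ℕ → Lp ℂ 2 (volume : Measure ℝ))
    (hU : ∀ k, U k =ᵐ[volume] fun t => (∏ j ∈ Finset.range k, (criticalPoint t - r j)) * Z t) :
    (Submodule.span ℂ (range U)).topologicalClosure = ⊤ := by
  have hσ := continuous_criticalPoint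
  have hC : 0 ≤ C := by
    have := (norm_nonneg _).trans (hZ 0)
    simpa using this
  rw [Submodule.topologicalClosure_eq_top_iff, Submodule.eq_bot_iff]
  intro h hh
  have hperp : ∀ k, inner ℂ h (U k) = 0 := fun k =>
    Submodule.mem_orthogonal' _ _ |>.1 hh _ (Submodule.subset_span ⟨k, rfl⟩)
  have hhm : MemLp h 2 := Lp.memLp h
  set φ : ℝ → ℂ := fun t => Z t * (starRingEnd ℂ) (h t) with hφdef
  have hφm : AEStronglyMeasurable φ :=
    hZc.aestronglyMeasurable.mul (Complex.continuous_conj.comp_aestronglyMeasurable hhm.1)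
  have hφ2 : MemLp φ 2 := by
    refine hhm.of_le_mul (c := C) hφm (Eventually.of_forall fun t => ?_)
    rw [norm_mul, RCLike.norm_conj]
    gcongr
    refine (hZ t).trans (mul_le_of_le_one_right hC ?_)
    rw [Real.exp_le_one_iff]
    have := abs_nonneg t
    nlinarith
  -- Because ‖σ‖ ≤ 1/2 + 2π|t|, the weight e^{c‖σ‖} then costs only half of the decay e^{-b|t|};
  -- what is left is still in L² and pairs with h.
  have hc : 0 < b / (4 * Real.pi) := by positivity
  set c := b / (4 * Real.pi) with hcdef
  have hE : MemLp (fun t => Real.exp (c * ‖criticalPoint t‖) * ‖Z t‖) 2 := by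
    have h1 : MemLp (fun t : ℝ => Real.exp (-(b / 2) * |t|)) 2 := by
      rw [memLp_two_iff_integrable_sq (by fun_prop)]
      refine (integrable_exp_neg_mul_abs hb).congr (Eventually.of_forall fun t => ?_)
      simp only [sq, ← Real.exp_add]
      ring_nf
    refine h1.of_le_mul (c := C * Real.exp (c * (1 / 2))) (by fun_prop)
      (Eventually.of_forall fun t => ?_)
    rw [Real.norm_of_nonneg (by positivity), Real.norm_of_nonneg (by positivity)]
    calc Real.exp (c * ‖criticalPoint t‖) * ‖Z t‖
        ≤ Real.exp (c * (1 / 2 + 2 * Real.pi * |t|)) * (C * Real.exp (-b * |t|)) := by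
          gcongr
          · exact norm_criticalPoint_le t
          · exact hZ t
      _ = C * (Real.exp (c * (1 / 2 + 2 * Real.pi * |t|)) * Real.exp (-b * |t|)) := by ring
      _ = C * (Real.exp (c * (1 / 2)) * Real.exp (-(b / 2) * |t|)) := by
          rw [← Real.exp_add, ← Real.exp_add]
          congr 2
          rw [hcdef]
          field_simp
          ring
      _ = _ := by ring
  have hI : Integrable fun t => Real.exp (c * ‖criticalPoint t‖) * ‖φ t‖ := by
    refine (hE.integrable_mul hhm.norm).congr (Eventually.of_forall fun t => ?_)
    simp [hφdef, mul_assoc]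
  have hφI : Integrable φ := by
    refine hI.mono hφm (Eventually.of_forall fun t => ?_)
    rw [Real.norm_of_nonneg (by positivity)]
    exact le_mul_of_one_le_left (norm_nonneg _) (Real.one_le_exp (by positivity))
  -- Induction on m for all k at once, by s^{m+1}P_k = s^m P_{k+1} + r_k s^m P_k; the case k = 0
  -- gives the plain moments.
  have hpoly : ∀ m k : ℕ,
      Integrable (fun t =>
        φ t * (criticalPoint t ^ m * ∏ j ∈ Finset.range k, (criticalPoint t - r j))) ∧
      ∫ t, φ t * (criticalPoint t ^ m * ∏ j ∈ Finset.range k, (criticalPoint t - r j)) = 0 := by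
    intro m
    induction m with
    | zero =>
      intro k
      have hae : (fun t => inner ℂ (h t) (U k t)) =ᵐ[volume] fun t =>
          φ t * (criticalPoint t ^ 0 * ∏ j ∈ Finset.range k, (criticalPoint t - r j)) := by
        filter_upwards [hU k] with t ht
        rw [ht, RCLike.inner_apply, hφdef]
        ring
      refine ⟨(L2.integrable_inner h (U k)).congr hae, ?_⟩
      rw [← integral_congr_ae hae, ← L2.inner_def, hperp k]
    | succ m ih =>
      intro k
      have hrec : ∀ t, φ t * (criticalPoint t ^ (m + 1) *
            ∏ j ∈ Finset.range k, (criticalPoint t - r j)) =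
          φ t * (criticalPoint t ^ m * ∏ j ∈ Finset.range (k + 1), (criticalPoint t - r j)) +
          r k * (φ t * (criticalPoint t ^ m *
            ∏ j ∈ Finset.range k, (criticalPoint t - r j))) := by
        intro t
        rw [Finset.prod_range_succ]
        ring
      simp only [hrec]
      refine ⟨(ih (k + 1)).1.add ((ih k).1.const_mul _), ?_⟩
      rw [integral_add (ih (k + 1)).1 ((ih k).1.const_mul _), integral_const_mul,
        (ih (k + 1)).2, (ih k).2, mul_zero, add_zero]
  have hφ0 := ae_eq_zero_of_moments_eq_zero hc hI hφI hφ2 fun n => by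
    simpa using (hpoly n 0).2
  rw [Lp.eq_zero_iff_ae_eq_zero]
  filter_upwards [hφ0, hZ0] with t h1 h2
  simpa [hφdef, h2] using h1

/-! ### The Mellin transform of the fractional part and ζ -/

/-- The fractional part as a complex valued function. -/
noncomputable def complexFract (x : ℝ) : ℂ := ((Int.fract x : ℝ) : ℂ)

theorem measurable_complexFract : Measurable complexFract :=
  Complex.measurable_ofReal.comp measurable_fract

theorem norm_complexFract_le_one (x : ℝ) : ‖complexFract x‖ ≤ 1 := by
  rw [complexFract, Complex.norm_real, Real.norm_of_nonneg (Int.fract_nonneg x)]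
  exact (Int.fract_lt_one x).le

theorem norm_complexFract_le {x : ℝ} (hx : 0 ≤ x) : ‖complexFract x‖ ≤ x := by
  rw [complexFract, Complex.norm_real, Real.norm_of_nonneg (Int.fract_nonneg x)]
  have : (0 : ℝ) ≤ ⌊x⌋ := by exact_mod_cast Int.floor_nonneg.2 hx
  linarith [Int.self_sub_floor x]

theorem locallyIntegrableOn_of_norm_le_one {f : ℝ → ℂ} (hf : Measurable f)
    (h : ∀ x, ‖f x‖ ≤ 1) (s : Set ℝ) : LocallyIntegrableOn f s :=
  ((locallyIntegrable_const (1 : ℝ)).mono hf.aestronglyMeasurable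
    (Eventually.of_forall fun x => by simpa using h x)).locallyIntegrableOn s

theorem mellinConvergent_complexFract {s : ℂ} (h0 : -1 < s.re) (h1 : s.re < 0) :
    MellinConvergent complexFract s := by
  refine mellinConvergent_of_isBigO_rpow (a := 0) (b := -1)
    (locallyIntegrableOn_of_norm_le_one measurable_complexFract norm_complexFract_le_one _)
    ?_ h1 ?_ h0
  · refine Asymptotics.IsBigO.of_bound 1 (Eventually.of_forall fun x => ?_)
    simpa using norm_complexFract_le_one x
  · refine Asymptotics.IsBigO.of_bound 1 ?_
    filter_upwards [self_mem_nhdsWithin] with x hx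
    simpa [abs_of_pos (mem_Ioi.1 hx)] using norm_complexFract_le (mem_Ioi.1 hx).le

/-- The fractional part restricted to `(1, ∞)`. -/
noncomputable def fractTail : ℝ → ℂ := (Ioi (1 : ℝ)).indicator complexFract

theorem measurable_fractTail : Measurable fractTail :=
  measurable_complexFract.indicator measurableSet_Ioi

theorem norm_fractTail_le_one (x : ℝ) : ‖fractTail x‖ ≤ 1 :=
  (norm_indicator_le_norm_self _ _).trans (norm_complexFract_le_one x)

theorem fractTail_isBigO_top : fractTail =O[atTop] fun x : ℝ => x ^ (-(0 : ℝ)) := by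
  refine Asymptotics.IsBigO.of_bound 1 (Eventually.of_forall fun x => ?_)
  simpa using norm_fractTail_le_one x

theorem fractTail_isBigO_zero (b : ℝ) : fractTail =O[𝓝[>] 0] fun x : ℝ => x ^ (-b) := by
  refine Asymptotics.IsBigO.of_bound 1 ?_
  have : ∀ᶠ x : ℝ in 𝓝[>] 0, x < 1 := nhdsWithin_le_nhds (Iio_mem_nhds one_pos)
  filter_upwards [this] with x hx
  rw [fractTail, indicator_of_notMem (by simpa using hx.le)]
  simp

/-- Removing (0,1] frees the transform from the strip -1 < Re s < 0. At -s it is then available for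
Re s > 1, where ζ is a Dirichlet series. -/
theorem mellinConvergent_fractTail {s : ℂ} (hs : s.re < 0) : MellinConvergent fractTail s :=
  mellinConvergent_of_isBigO_rpow (b := s.re - 1)
    (locallyIntegrableOn_of_norm_le_one measurable_fractTail norm_fractTail_le_one _)
    fractTail_isBigO_top hs (fractTail_isBigO_zero _) (by linarith)

theorem differentiableAt_mellin_fractTail {s : ℂ} (hs : s.re < 0) :
    DifferentiableAt ℂ (mellin fractTail) s :=
  mellin_differentiableAt_of_isBigO_rpow (b := s.re - 1)
    (locallyIntegrableOn_of_norm_le_one measurable_fractTail norm_fractTail_le_one _)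
    fractTail_isBigO_top hs (fractTail_isBigO_zero _) (by linarith)

theorem mellin_fractTail (s : ℂ) :
    mellin fractTail (-s) = ∫ x in Ioi (1 : ℝ), complexFract x * (x : ℂ) ^ (-(s + 1)) := by
  rw [mellin, ← integral_indicator measurableSet_Ioi, ← integral_indicator measurableSet_Ioi]
  congr 1 with x
  by_cases hx : 1 < x
  · rw [indicator_of_mem (by simpa using one_pos.trans hx), indicator_of_mem (by simpa using hx),
      fractTail, indicator_of_mem (by simpa using hx), smul_eq_mul, mul_comm]
    ring_nf
  · rw [indicator_of_notMem (s := Ioi 1) (by simpa using hx)]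
    apply indicator_apply_eq_zero.2
    intro _
    rw [fractTail, indicator_of_notMem (by simpa using hx), smul_zero]

theorem integrableOn_fract_mul_cpow {s : ℂ} (hs : 0 < s.re) :
    IntegrableOn (fun x : ℝ => complexFract x * (x : ℂ) ^ (-(s + 1))) (Ioi 1) := by
  refine (integrableOn_Ioi_cpow_of_lt (a := -(s + 1)) (by simp; linarith) one_pos).bdd_mul
    (c := 1) measurable_complexFract.aestronglyMeasurable
    (Eventually.of_forall norm_complexFract_le_one)

/-- Abel summation gives ζ(s) = s∫_1^∞ ⌊x⌋x^{-s-1}dx; then split ⌊x⌋ = x - {x}. -/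
theorem riemannZeta_eq_of_one_lt_re {s : ℂ} (hs : 1 < s.re) :
    riemannZeta s = s * (1 / (s - 1) - mellin fractTail (-s)) := by
  have h1 : s - 1 ≠ 0 := by
    intro h
    have := congrArg Complex.re h
    simp at this
    linarith
  rw [← LSeries_one_eq_riemannZeta hs]
  have h := LSeries_eq_mul_integral_of_nonneg (fun _ => 1) zero_le_one hs ?_ (by simp)
  · simp only [Complex.ofReal_one, Finset.sum_const, Nat.card_Icc, add_tsub_cancel_right,
      nsmul_eq_mul, mul_one] at h
    rw [show (1 : ℕ → ℂ) = fun _ => 1 from rfl, h, mellin_fractTail]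
    congr 1
    have hi : ∫ x in Ioi (1 : ℝ), (x : ℂ) ^ (-s) = 1 / (s - 1) := by
      rw [integral_Ioi_cpow_of_lt (by simpa using hs) one_pos]
      simp only [Complex.ofReal_one, Complex.one_cpow]
      rw [← neg_sub, show -s + 1 = -(s - 1) by ring, neg_div_neg_eq]
      simp
    rw [← hi, ← integral_sub (integrableOn_Ioi_cpow_of_lt (by simpa using hs) one_pos)
      (integrableOn_fract_mul_cpow (by linarith))]
    refine setIntegral_congr_fun measurableSet_Ioi fun x hx => ?_
    have hx0 : (0 : ℝ) < x := one_pos.trans hx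
    have hfl : ((⌊x⌋₊ : ℕ) : ℂ) = (x : ℂ) - complexFract x := by
      rw [complexFract, ← Int.self_sub_floor, ← natCast_floor_eq_intCast_floor hx0.le]
      push_cast
      ring
    rw [hfl, sub_mul]
    congr 1
    have hx1 : (x : ℂ) ≠ 0 := by exact_mod_cast hx0.ne'
    rw [neg_add, Complex.cpow_add _ _ hx1, Complex.cpow_neg_one]
    field_simp
  · simp only [Finset.sum_const, Nat.card_Icc, add_tsub_cancel_right, nsmul_eq_mul, mul_one,
      Real.rpow_one]
    exact Asymptotics.isBigO_refl _ _

/-- Multiplied by s - 1, both sides are holomorphic on the whole half-plane, s = 1 included, so the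
identity theorem applies from a neighbourhood of 2. -/
theorem riemannZeta_eq_of_re_pos {s : ℂ} (hs : 0 < s.re) (hs1 : s ≠ 1) :
    riemannZeta s = s * (1 / (s - 1) - mellin fractTail (-s)) := by
  have hU : IsOpen {s : ℂ | 0 < s.re} := isOpen_lt continuous_const Complex.continuous_re
  have hpre : IsPreconnected {s : ℂ | 0 < s.re} :=
    (convex_halfSpace_re_gt 0).isPreconnected
  have hF : AnalyticOnNhd ℂ riemannZeta₁ {s : ℂ | 0 < s.re} :=
    (differentiable_riemannZeta₁.differentiableOn).analyticOnNhd hU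
  have hG : AnalyticOnNhd ℂ (fun s => s - s * (s - 1) * mellin fractTail (-s))
      {s : ℂ | 0 < s.re} := by
    refine DifferentiableOn.analyticOnNhd (fun s hs => ?_) hU
    have hd : DifferentiableAt ℂ (fun s => mellin fractTail (-s)) s :=
      DifferentiableAt.comp (g := mellin fractTail) s
        (differentiableAt_mellin_fractTail (by simpa using hs)) differentiableAt_id.neg
    exact (differentiableAt_id.sub
      ((differentiableAt_id.mul (differentiableAt_id.sub_const 1)).mul hd)).differentiableWithinAt
  have heq : riemannZeta₁ =ᶠ[𝓝 2] fun s => s - s * (s - 1) * mellin fractTail (-s) := by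
    have : {s : ℂ | 1 < s.re} ∈ 𝓝 (2 : ℂ) :=
      (isOpen_lt continuous_const Complex.continuous_re).mem_nhds (by simp)
    filter_upwards [this] with s hs
    have h1 : s ≠ 1 := by
      rintro rfl
      simp at hs
    have h2 := riemannZeta_eq_of_one_lt_re hs
    rw [riemannZeta_eq_inv_sub_mul h1] at h2
    have h3 : s - 1 ≠ 0 := sub_ne_zero.2 h1
    field_simp at h2
    rw [h2]
    ring
  have := hF.eqOn_of_preconnected_of_eventuallyEq hG hpre (by simp) heq hs
  have h3 : s - 1 ≠ 0 := sub_ne_zero.2 hs1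
  rw [riemannZeta_eq_inv_sub_mul hs1, this]
  field_simp

/-- The Mellin transform of the fractional part in the strip where it converges. -/
theorem mellin_complexFract {s : ℂ} (h0 : 0 < s.re) (h1 : s.re < 1) :
    mellin complexFract (-s) = -(riemannZeta s / s) := by
  have hs1 : s ≠ 1 := by
    rintro rfl
    simp at h1
  have hs0 : s ≠ 0 := by
    rintro rfl
    simp at h0
  -- On (0,1) the fractional part is x, which contributes 1/(1 - s) and so accounts for the polar
  -- term.
  have hI := hasMellin_cpow_Ioc 1 (s := -s) (by simpa using h1)
  have hadd := hasMellin_add (mellinConvergent_fractTail (s := -s) (by simpa using h0)) hI.1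
  have hcongr : mellin complexFract (-s) =
      mellin (fun t => fractTail t + (Ioc (0 : ℝ) 1).indicator (fun t : ℝ => (t : ℂ) ^ (1 : ℂ)) t)
        (-s) := by
    rw [mellin, mellin]
    apply integral_congr_ae
    have hne : ∀ᵐ x : ℝ ∂volume.restrict (Ioi 0), x ≠ 1 :=
      ae_restrict_of_ae (Measure.ae_ne volume 1)
    filter_upwards [hne, ae_restrict_mem measurableSet_Ioi] with x hx hx0
    congr 1
    rcases lt_or_gt_of_ne hx with h | h
    · rw [fractTail, indicator_of_notMem (by simpa using h.le),
        indicator_of_mem (show x ∈ Ioc (0 : ℝ) 1 from ⟨hx0, h.le⟩), complexFract,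
        Int.fract_eq_self.2 ⟨(mem_Ioi.1 hx0).le, h⟩]
      simp
    · rw [fractTail, indicator_of_mem (by simpa using h),
        indicator_of_notMem (fun hm => absurd hm.2 (not_le.2 h)), add_zero]
  rw [hcongr, hadd.2, hI.2, riemannZeta_eq_of_re_pos h0 hs1]
  have h3 : s - 1 ≠ 0 := sub_ne_zero.2 hs1
  have h4 : -s + 1 ≠ 0 := by
    intro h
    apply h3
    linear_combination -h
  rw [mul_div_cancel_left₀ _ hs0]
  have : 1 / (-s + 1) = -(1 / (s - 1)) := by
    rw [show -s + 1 = -(s - 1) by ring, one_div, one_div, inv_neg]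
  rw [this]
  ring

/-! ### Functions with decay at both ends -/

/-- Continuity on `(0, ∞)` with a power saving over `1` at `0` and over `x⁻¹` at `∞`. -/
def StripDecay (f : ℝ → ℝ) : Prop :=
  ContinuousOn f (Ioi 0) ∧ ∃ α : ℝ, 0 < α ∧
    f =O[𝓝[>] 0] (fun x : ℝ => x ^ α) ∧ f =O[atTop] fun x : ℝ => x ^ (-(1 + α))

theorem eventually_pos_nhdsGT_zero_lt_one : ∀ᶠ x : ℝ in 𝓝[>] 0, 0 < x ∧ x < 1 := by
  have : ∀ᶠ x : ℝ in 𝓝[>] 0, x < 1 := nhdsWithin_le_nhds (Iio_mem_nhds one_pos)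
  filter_upwards [this, self_mem_nhdsWithin] with x h1 h2 using ⟨h2, h1⟩

theorem isBigO_rpow_rpow_nhdsGT_zero {a b : ℝ} (h : a ≤ b) :
    (fun x : ℝ => x ^ b) =O[𝓝[>] 0] fun x : ℝ => x ^ a := by
  refine Asymptotics.IsBigO.of_bound 1 ?_
  filter_upwards [eventually_pos_nhdsGT_zero_lt_one] with x hx
  rw [one_mul, Real.norm_of_nonneg (Real.rpow_nonneg hx.1.le _),
    Real.norm_of_nonneg (Real.rpow_nonneg hx.1.le _)]
  exact Real.rpow_le_rpow_of_exponent_ge hx.1 hx.2.le h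

theorem isBigO_rpow_rpow_atTop {a b : ℝ} (h : a ≤ b) :
    (fun x : ℝ => x ^ a) =O[atTop] fun x : ℝ => x ^ b := by
  refine Asymptotics.IsBigO.of_bound 1 ?_
  filter_upwards [eventually_ge_atTop 1] with x hx
  have hx0 : 0 ≤ x := zero_le_one.trans hx
  rw [one_mul, Real.norm_of_nonneg (Real.rpow_nonneg hx0 _),
    Real.norm_of_nonneg (Real.rpow_nonneg hx0 _)]
  exact Real.rpow_le_rpow_of_exponent_le hx h

namespace StripDecay

theorem zero : StripDecay 0 :=
  ⟨continuousOn_const, 1, one_pos, Asymptotics.isBigO_zero _ _, Asymptotics.isBigO_zero _ _⟩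

theorem add {f h : ℝ → ℝ} (hf : StripDecay f) (hh : StripDecay h) : StripDecay (f + h) := by
  obtain ⟨hfc, α, hα, hf0, hf1⟩ := hf
  obtain ⟨hhc, β, hβ, hh0, hh1⟩ := hh
  refine ⟨hfc.add hhc, min α β, lt_min hα hβ, ?_, ?_⟩
  · exact (hf0.trans (isBigO_rpow_rpow_nhdsGT_zero (min_le_left _ _))).add
      (hh0.trans (isBigO_rpow_rpow_nhdsGT_zero (min_le_right _ _)))
  · exact (hf1.trans (isBigO_rpow_rpow_atTop (by linarith [min_le_left α β]))).add
      (hh1.trans (isBigO_rpow_rpow_atTop (by linarith [min_le_right α β])))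

theorem smul {f : ℝ → ℝ} (c : ℝ) (hf : StripDecay f) : StripDecay (c • f) := by
  obtain ⟨hfc, α, hα, hf0, hf1⟩ := hf
  exact ⟨hfc.const_smul c, α, hα, hf0.const_smul_left c, hf1.const_smul_left c⟩

theorem congr {f h : ℝ → ℝ} (hf : StripDecay f) (hfh : EqOn h f (Ioi 0)) : StripDecay h := by
  obtain ⟨hfc, α, hα, hf0, hf1⟩ := hf
  refine ⟨hfc.congr hfh, α, hα, hf0.congr' ?_ EventuallyEq.rfl, hf1.congr' ?_ EventuallyEq.rfl⟩
  · filter_upwards [self_mem_nhdsWithin] with x hx using (hfh hx).symm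
  · filter_upwards [Ioi_mem_atTop 0] with x hx using (hfh hx).symm

theorem continuousOn_ofReal {f : ℝ → ℝ} (hf : StripDecay f) :
    ContinuousOn (fun x => (f x : ℂ)) (Ioi 0) :=
  Complex.continuous_ofReal.comp_continuousOn hf.1

/-- The closed strip matters: its edges Re s = 1 and Re s = 0 give the integrability of f and of
f(x)/x. -/
theorem mellinConvergent {f : ℝ → ℝ} (hf : StripDecay f) {s : ℂ} (h0 : 0 ≤ s.re)
    (h1 : s.re ≤ 1) : MellinConvergent (fun x => (f x : ℂ)) s := by
  have hc := hf.continuousOn_ofReal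
  obtain ⟨hfc, α, hα, hf0, hf1⟩ := hf
  exact mellinConvergent_of_isBigO_rpow (a := 1 + α) (b := -α)
    (hc.locallyIntegrableOn measurableSet_Ioi)
    (Complex.isBigO_ofReal_left.2 hf1) (by linarith)
    (Complex.isBigO_ofReal_left.2 (by simpa using hf0)) (by linarith)

theorem differentiableAt_mellin {f : ℝ → ℝ} (hf : StripDecay f) {s : ℂ} (h0 : 0 ≤ s.re)
    (h1 : s.re ≤ 1) : DifferentiableAt ℂ (mellin fun x => (f x : ℂ)) s := by
  have hc := hf.continuousOn_ofReal
  obtain ⟨hfc, α, hα, hf0, hf1⟩ := hf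
  exact mellin_differentiableAt_of_isBigO_rpow (a := 1 + α) (b := -α)
    (hc.locallyIntegrableOn measurableSet_Ioi)
    (Complex.isBigO_ofReal_left.2 hf1) (by linarith)
    (Complex.isBigO_ofReal_left.2 (by simpa using hf0)) (by linarith)

theorem integrableOn {f : ℝ → ℝ} (hf : StripDecay f) : IntegrableOn f (Ioi 0) := by
  have := hf.mellinConvergent (s := 1) (by simp) (by simp)
  simp only [MellinConvergent, sub_self, Complex.cpow_zero, one_smul] at this
  simpa [IntegrableOn] using Integrable.re this

theorem integrableOn_div {f : ℝ → ℝ} (hf : StripDecay f) :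
    IntegrableOn (fun x => f x / x) (Ioi 0) := by
  have := hf.mellinConvergent (s := 0) (by simp) (by simp)
  simp only [MellinConvergent, zero_sub, Complex.cpow_neg_one, smul_eq_mul] at this
  refine (Integrable.re this).congr (Eventually.of_forall fun x => ?_)
  simp only
  rw [← Complex.ofReal_inv, ← Complex.ofReal_mul]
  rw [RCLike.re_eq_complex_re, Complex.ofReal_re, div_eq_inv_mul]

theorem memLp_two {f : ℝ → ℝ} (hf : StripDecay f) :
    MemLp f 2 (volume.restrict (Ioi (0 : ℝ))) := by
  rw [memLp_two_iff_integrable_sq (hf.1.aestronglyMeasurable measurableSet_Ioi)]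
  obtain ⟨hfc, α, hα, hf0, hf1⟩ := hf
  have : StripDecay (f ^ 2) := by
    refine ⟨hfc.pow 2, α, hα, ?_, ?_⟩
    · have h1 := (hf0.pow 2).trans (g := fun x : ℝ => (x ^ α) ^ 2)
        (Asymptotics.isBigO_refl _ _)
      refine h1.trans ((isBigO_rpow_rpow_nhdsGT_zero (a := α) (b := α * 2) (by linarith)).congr'
        ?_ EventuallyEq.rfl)
      filter_upwards [self_mem_nhdsWithin] with x hx
      rw [Real.rpow_mul (mem_Ioi.1 hx).le, Real.rpow_two]
    · have h1 := (hf1.pow 2).trans (g := fun x : ℝ => (x ^ (-(1 + α))) ^ 2)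
        (Asymptotics.isBigO_refl _ _)
      refine h1.trans ((isBigO_rpow_rpow_atTop (a := -(1 + α) * 2) (b := -(1 + α))
        (by linarith)).congr' ?_ EventuallyEq.rfl)
      filter_upwards [Ioi_mem_atTop 0] with x hx
      rw [Real.rpow_mul (mem_Ioi.1 hx).le, Real.rpow_two]
  exact this.integrableOn

end StripDecay

/-! ### The Euler operator and the recursion -/

theorem ContDiffOn.hasDerivAt_iteratedDeriv {f : ℝ → ℝ} {U : Set ℝ} (hU : IsOpen U)
    (hf : ContDiffOn ℝ ∞ f U) (j : ℕ) {x : ℝ} (hx : x ∈ U) :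
    HasDerivAt (iteratedDeriv j f) (iteratedDeriv (j + 1) f x) x := by
  have h1 : DifferentiableOn ℝ (iteratedDerivWithin j f U) U :=
    hf.differentiableOn_iteratedDerivWithin (by exact_mod_cast WithTop.coe_lt_top _)
      hU.uniqueDiffOn
  have h2 : DifferentiableOn ℝ (iteratedDeriv j f) U :=
    h1.congr fun y hy => (iteratedDerivWithin_of_isOpen hU hy).symm
  rw [iteratedDeriv_succ]
  exact (h2.differentiableAt (hU.mem_nhds hx)).hasDerivAt

/-- The functions `x ^ j f⁽ʲ⁾(x)`. -/
noncomputable def eulerTerm (f : ℝ → ℝ) (j : ℕ) (x : ℝ) : ℝ := x ^ j * iteratedDeriv j f x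

theorem hasDerivAt_eulerTerm {f : ℝ → ℝ} (hf : ContDiffOn ℝ ∞ f (Ioi 0)) (j : ℕ) {x : ℝ}
    (hx : 0 < x) :
    HasDerivAt (eulerTerm f j) ((j * eulerTerm f j x + eulerTerm f (j + 1) x) / x) x := by
  have h := (hasDerivAt_pow j x).mul (hf.hasDerivAt_iteratedDeriv isOpen_Ioi j hx)
  refine HasDerivAt.congr_deriv (f := eulerTerm f j) h ?_
  rcases j with _ | j
  · simp only [eulerTerm, Nat.cast_zero, zero_mul, pow_zero, zero_add, pow_one, one_mul]
    field_simp
  · simp only [eulerTerm, Nat.add_sub_cancel]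
    field_simp
    ring

theorem isBigO_of_tendsto_rpow_mul {l : Filter ℝ} (hl : ∀ᶠ x in l, 0 < x) {F : ℝ → ℝ} {p : ℝ}
    (h : Tendsto (fun x => x ^ p * F x) l (𝓝 0)) : F =O[l] fun x => x ^ (-p) := by
  have h1 := (Asymptotics.isBigO_refl (fun x : ℝ => x ^ (-p)) l).mul (h.isBigO_one ℝ)
  refine h1.congr' ?_ (by simp)
  filter_upwards [hl] with x hx
  rw [← mul_assoc, ← Real.rpow_add hx]
  simp

theorem stripDecay_eulerTerm {f : ℝ → ℝ} (hf : ContDiffOn ℝ ∞ f (Ioi 0)) (j : ℕ)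
    (h : ∃ α : ℝ, 0 < α ∧
      Tendsto (fun x : ℝ => x ^ ((j : ℝ) - α) * iteratedDeriv j f x) (𝓝[>] 0) (𝓝 0) ∧
      Tendsto (fun x : ℝ => x ^ ((j : ℝ) + 1 + α) * iteratedDeriv j f x) atTop (𝓝 0)) :
    StripDecay (eulerTerm f j) := by
  obtain ⟨α, hα, h0, h1⟩ := h
  refine ⟨fun x hx => (hasDerivAt_eulerTerm hf j hx).continuousAt.continuousWithinAt,
    α, hα, ?_, ?_⟩
  · have : Tendsto (fun x : ℝ => x ^ (-α) * eulerTerm f j x) (𝓝[>] 0) (𝓝 0) := by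
      refine h0.congr' ?_
      filter_upwards [self_mem_nhdsWithin] with x hx
      rw [eulerTerm, ← mul_assoc, ← Real.rpow_natCast, ← Real.rpow_add hx]
      congr 2
      ring
    simpa using isBigO_of_tendsto_rpow_mul (l := 𝓝[>] 0)
      (eventually_pos_nhdsGT_zero_lt_one.mono fun _ h => h.1) this
  · have : Tendsto (fun x : ℝ => x ^ (1 + α) * eulerTerm f j x) atTop (𝓝 0) := by
      refine h1.congr' ?_
      filter_upwards [Ioi_mem_atTop 0] with x hx
      rw [eulerTerm, ← mul_assoc, ← Real.rpow_natCast, ← Real.rpow_add hx]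
      congr 2
      ring
    exact isBigO_of_tendsto_rpow_mul (Ioi_mem_atTop 0) this

theorem stripDecay_of_mem_span {f F : ℝ → ℝ} (hd : ∀ j, StripDecay (eulerTerm f j))
    (hF : F ∈ Submodule.span ℝ (range (eulerTerm f))) : StripDecay F := by
  induction hF using Submodule.span_induction with
  | mem x h => obtain ⟨j, rfl⟩ := h; exact hd j
  | zero => exact StripDecay.zero
  | add x y _ _ hx hy => exact hx.add hy
  | smul a x _ hx => exact hx.smul a

/-- The span of the x^j f⁽ʲ⁾ is stable under x d/dx. Hence every g_k agrees with an element of it on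
(0,∞) and inherits smoothness and decay. -/
theorem exists_mem_span_hasDerivAt {f F : ℝ → ℝ} (hf : ContDiffOn ℝ ∞ f (Ioi 0))
    (hF : F ∈ Submodule.span ℝ (range (eulerTerm f))) :
    ∃ G ∈ Submodule.span ℝ (range (eulerTerm f)), ∀ x, 0 < x → HasDerivAt F (G x / x) x := by
  induction hF using Submodule.span_induction with
  | mem x h =>
    obtain ⟨j, rfl⟩ := h
    refine ⟨(j : ℝ) • eulerTerm f j + eulerTerm f (j + 1), ?_, fun x hx => ?_⟩
    · exact add_mem (Submodule.smul_mem _ _ (Submodule.subset_span ⟨_, rfl⟩))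
        (Submodule.subset_span ⟨_, rfl⟩)
    · simpa using hasDerivAt_eulerTerm hf j hx
  | zero => exact ⟨0, zero_mem _, fun x _ =>
      (hasDerivAt_const x (0 : ℝ)).congr_deriv (by simp)⟩
  | add u v _ _ hu hv =>
    obtain ⟨U, hU, hU'⟩ := hu
    obtain ⟨V, hV, hV'⟩ := hv
    exact ⟨U + V, add_mem hU hV, fun x hx =>
      ((hU' x hx).add (hV' x hx)).congr_deriv (by simp [add_div])⟩
  | smul a u _ hu =>
    obtain ⟨U, hU, hU'⟩ := hu
    exact ⟨a • U, Submodule.smul_mem _ _ hU, fun x hx =>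
      ((hU' x hx).const_smul a).congr_deriv (by simp [mul_div_assoc])⟩

theorem exists_mem_span_eqOn {g : ℕ → ℝ → ℝ} {r : ℕ → ℝ}
    (hsmooth : ContDiffOn ℝ ∞ (g 0) (Ioi (0 : ℝ)))
    (hrec : ∀ k : ℕ, ∀ x : ℝ, 0 < x → g (k + 1) x = -x * deriv (g k) x - r k * g k x) (k : ℕ) :
    ∃ F ∈ Submodule.span ℝ (range (eulerTerm (g 0))), EqOn (g k) F (Ioi 0) := by
  induction k with
  | zero => exact ⟨eulerTerm (g 0) 0, Submodule.subset_span ⟨0, rfl⟩, fun x _ => by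
      simp [eulerTerm]⟩
  | succ k ih =>
    obtain ⟨F, hF, hgF⟩ := ih
    obtain ⟨G, hG, hFG⟩ := exists_mem_span_hasDerivAt hsmooth hF
    refine ⟨(-1 : ℝ) • G - r k • F, sub_mem (Submodule.smul_mem _ _ hG)
      (Submodule.smul_mem _ _ hF), fun x hx => ?_⟩
    have hx0 : 0 < x := hx
    have hd : deriv (g k) x = G x / x := by
      rw [(hgF.eventuallyEq_of_mem (isOpen_Ioi.mem_nhds hx)).deriv_eq, (hFG x hx).deriv]
    rw [hrec k x hx, hd, hgF hx]
    simp only [Pi.sub_apply, Pi.smul_apply, smul_eq_mul]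
    field_simp

theorem stripDecay_of_recursion {g : ℕ → ℝ → ℝ} {r : ℕ → ℝ}
    (hsmooth : ContDiffOn ℝ ∞ (g 0) (Ioi (0 : ℝ)))
    (hd : ∀ j, StripDecay (eulerTerm (g 0) j))
    (hrec : ∀ k : ℕ, ∀ x : ℝ, 0 < x → g (k + 1) x = -x * deriv (g k) x - r k * g k x) (k : ℕ) :
    StripDecay (g k) ∧ ∀ x, 0 < x → HasDerivAt (g k) (deriv (g k) x) x := by
  obtain ⟨F, hF, hgF⟩ := exists_mem_span_eqOn hsmooth hrec k
  obtain ⟨G, hG, hFG⟩ := exists_mem_span_hasDerivAt hsmooth hF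
  refine ⟨(stripDecay_of_mem_span hd hF).congr hgF, fun x hx => ?_⟩
  have := (hFG x hx).congr_of_eventuallyEq
    (hgF.eventuallyEq_of_mem (isOpen_Ioi.mem_nhds (mem_Ioi.2 hx)))
  exact this.differentiableAt.hasDerivAt

/-- These are the boundary terms of the integration by parts in `mellin_eulerOperator`. -/
theorem StripDecay.tendsto_mul_cpow {f : ℝ → ℝ} (hf : StripDecay f) {s : ℂ} (h0 : 0 ≤ s.re)
    (h1 : s.re ≤ 1) :
    Tendsto (fun x : ℝ => (f x : ℂ) * (x : ℂ) ^ s) (𝓝[>] 0) (𝓝 0) ∧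
      Tendsto (fun x : ℝ => (f x : ℂ) * (x : ℂ) ^ s) atTop (𝓝 0) := by
  obtain ⟨hfc, α, hα, hf0, hf1⟩ := hf
  have key : ∀ {l : Filter ℝ} {p : ℝ}, (∀ᶠ x in l, 0 < x) → f =O[l] (fun x => x ^ p) →
      Tendsto (fun x : ℝ => x ^ (p + s.re)) l (𝓝 0) →
      Tendsto (fun x : ℝ => (f x : ℂ) * (x : ℂ) ^ s) l (𝓝 0) := by
    intro l p hl hO ht
    have hO2 : (fun x : ℝ => (f x : ℂ) * (x : ℂ) ^ s) =O[l] fun x : ℝ => x ^ p * x ^ s.re := by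
      refine (Complex.isBigO_ofReal_left.2 hO).mul (Asymptotics.IsBigO.of_bound 1 ?_)
      filter_upwards [hl] with x hx
      rw [Complex.norm_cpow_eq_rpow_re_of_pos hx, one_mul]
      exact le_abs_self _
    refine hO2.trans_tendsto (ht.congr' ?_)
    filter_upwards [hl] with x hx
    rw [Real.rpow_add hx]
  refine ⟨key self_mem_nhdsWithin hf0 ?_, key (Ioi_mem_atTop 0) hf1 ?_⟩
  · have := (Real.continuousAt_rpow_const 0 (α + s.re) (Or.inr (by linarith))).tendsto
    rw [Real.zero_rpow (by linarith)] at this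
    exact this.mono_left nhdsWithin_le_nhds
  · have := tendsto_rpow_neg_atTop (y := 1 + α - s.re) (by linarith)
    refine this.congr fun x => ?_
    congr 1
    ring

/-- The Mellin transform turns `-x d/dx - r` into multiplication by `s - r`. -/
theorem mellin_eulerOperator {f h : ℝ → ℝ} {r : ℝ} (hf : StripDecay f) (hh : StripDecay h)
    (hd : ∀ x, 0 < x → HasDerivAt f (deriv f x) x)
    (hfh : ∀ x, 0 < x → h x = -x * deriv f x - r * f x) {s : ℂ} (h0 : 0 < s.re)
    (h1 : s.re ≤ 1) : realMellin h s = (s - r) * realMellin f s := by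
  have hs0 : s ≠ 0 := by
    rintro rfl
    simp at h0
  have hfM := hf.mellinConvergent h0.le h1
  have hhM := hh.mellinConvergent h0.le h1
  have hcp : ∀ x : ℝ, 0 < x → (x : ℂ) ^ s = (x : ℂ) ^ (s - 1) * x := by
    intro x hx
    have : (x : ℂ) ≠ 0 := by exact_mod_cast hx.ne'
    rw [Complex.cpow_sub _ _ this, Complex.cpow_one]
    field_simp
  -- Solving for f' in terms of h and f makes f'(x)x^s integrable without a separate estimate on f'.
  have hpt : ∀ x : ℝ, 0 < x → ((deriv f x : ℝ) : ℂ) * (x : ℂ) ^ s =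
      -((x : ℂ) ^ (s - 1) • (h x : ℂ)) - r * ((x : ℂ) ^ (s - 1) • (f x : ℂ)) := by
    intro x hx
    rw [hcp x hx, hfh x hx]
    push_cast
    simp only [smul_eq_mul]
    ring
  have hint : IntegrableOn (fun x : ℝ => -((x : ℂ) ^ (s - 1) • (h x : ℂ)) -
      r * ((x : ℂ) ^ (s - 1) • (f x : ℂ))) (Ioi 0) := hhM.neg.sub (hfM.const_mul _)
  have hlim := hf.tendsto_mul_cpow h0.le h1
  have ibp := integral_Ioi_mul_deriv_eq_deriv_mul (a := (0 : ℝ)) (a' := (0 : ℂ)) (b' := 0)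
    (u := fun x => (f x : ℂ)) (u' := fun x => ((deriv f x : ℝ) : ℂ))
    (v := fun x : ℝ => (x : ℂ) ^ s) (v' := fun x : ℝ => s * (x : ℂ) ^ (s - 1))
    (fun x hx => (hd x hx).ofReal_comp)
    (fun x hx => hasDerivAt_ofReal_cpow_const (ne_of_gt hx) hs0)
    ((hfM.const_mul s).congr (Eventually.of_forall fun x => by
      simp only [smul_eq_mul, Pi.mul_apply]; ring))
    (hint.congr_fun (fun x hx => (hpt x hx).symm) measurableSet_Ioi)
    hlim.1 hlim.2
  have e1 : ∫ x in Ioi (0 : ℝ), (f x : ℂ) * (s * (x : ℂ) ^ (s - 1)) = s * realMellin f s := by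
    rw [realMellin, mellin, ← integral_const_mul]
    congr 1 with x
    simp only [smul_eq_mul]
    ring
  have e2 : ∫ x in Ioi (0 : ℝ), ((deriv f x : ℝ) : ℂ) * (x : ℂ) ^ s =
      -realMellin h s - r * realMellin f s := by
    rw [setIntegral_congr_fun measurableSet_Ioi fun x hx => hpt x hx]
    refine (integral_sub hhM.neg (hfM.const_mul (r : ℂ))).trans ?_
    rw [integral_const_mul]
    congr 1
    exact integral_neg _
  rw [e1, e2] at ibp
  linear_combination -ibp

theorem realMellin_recursion {g : ℕ → ℝ → ℝ} {r : ℕ → ℝ}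
    (hg : ∀ k, StripDecay (g k) ∧ ∀ x, 0 < x → HasDerivAt (g k) (deriv (g k) x) x)
    (hrec : ∀ k : ℕ, ∀ x : ℝ, 0 < x → g (k + 1) x = -x * deriv (g k) x - r k * g k x)
    {s : ℂ} (h0 : 0 < s.re) (h1 : s.re ≤ 1) (k : ℕ) :
    realMellin (g k) s = (∏ j ∈ Finset.range k, (s - (r j : ℂ))) * realMellin (g 0) s := by
  induction k with
  | zero => simp
  | succ k ih =>
    rw [mellin_eulerOperator (hg k).1 (hg (k + 1)).1 (hg k).2 (hrec k) h0 h1, ih,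
      Finset.prod_range_succ]
    ring

/-! ### The convolution with the fractional part -/

theorem abs_fract_le_one (y : ℝ) : |Int.fract y| ≤ 1 := by
  rw [abs_of_nonneg (Int.fract_nonneg y)]
  exact (Int.fract_lt_one y).le

theorem abs_fract_le {y : ℝ} (hy : 0 ≤ y) : |Int.fract y| ≤ y := by
  have := norm_complexFract_le hy
  rwa [complexFract, Complex.norm_real, Real.norm_eq_abs] at this

theorem fractConvIntegrand_eq (f : ℝ → ℝ) (t : ℝ) :
    fractConvIntegrand f t = fun x => Int.fract (x / t) * (f x / x) := by
  ext x
  rw [fractConvIntegrand, mul_div_assoc]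

namespace StripDecay

variable {f : ℝ → ℝ}

theorem aestronglyMeasurable_div (hf : StripDecay f) :
    AEStronglyMeasurable (fun x => f x / x) (volume.restrict (Ioi (0 : ℝ))) :=
  hf.integrableOn_div.1

theorem integrableOn_fractConvIntegrand (hf : StripDecay f) (t : ℝ) :
    IntegrableOn (fractConvIntegrand f t) (Ioi (0 : ℝ)) := by
  rw [fractConvIntegrand_eq]
  refine hf.integrableOn_div.bdd_mul (c := 1) ?_ (Eventually.of_forall fun x => ?_)
  · exact (measurable_fract.comp (measurable_id.div_const t)).aestronglyMeasurable
  · exact abs_fract_le_one _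

theorem abs_fractConv_le (hf : StripDecay f) (t : ℝ) :
    |fractConv f t| ≤ ∫ x in Ioi (0 : ℝ), |f x / x| := by
  refine (norm_integral_le_integral_norm (fractConvIntegrand f t)).trans ?_
  refine integral_mono (hf.integrableOn_fractConvIntegrand t).norm hf.integrableOn_div.norm
    fun x => ?_
  rw [fractConvIntegrand_eq]
  simp only [norm_mul, Real.norm_eq_abs]
  exact mul_le_of_le_one_left (abs_nonneg _) (abs_fract_le_one _)

theorem abs_mul_fractConv_le (hf : StripDecay f) {t : ℝ} (ht : 0 < t) :
    |t * fractConv f t| ≤ ∫ x in Ioi (0 : ℝ), |f x| := by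
  rw [fractConv, ← integral_const_mul]
  refine (norm_integral_le_integral_norm fun x => t * fractConvIntegrand f t x).trans ?_
  refine setIntegral_mono_on ((hf.integrableOn_fractConvIntegrand t).const_mul t).norm
    hf.integrableOn.norm measurableSet_Ioi fun x hx => ?_
  have hx0 : 0 < x := hx
  rw [fractConvIntegrand_eq]
  simp only [norm_mul, Real.norm_eq_abs, abs_div, abs_of_pos ht, abs_of_pos hx0]
  have h := abs_fract_le (y := x / t) (by positivity)
  calc t * (|Int.fract (x / t)| * (|f x| / x)) ≤ t * (x / t * (|f x| / x)) := by gcongr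
    _ = |f x| := by field_simp

theorem aestronglyMeasurable_fractConv (hf : StripDecay f) :
    AEStronglyMeasurable (fractConv f) (volume.restrict (Ioi (0 : ℝ))) := by
  have : AEStronglyMeasurable (fun p : ℝ × ℝ => Int.fract (p.2 / p.1) * (f p.2 / p.2))
      ((volume.restrict (Ioi (0 : ℝ))).prod (volume.restrict (Ioi (0 : ℝ)))) :=
    (measurable_fract.comp (measurable_snd.div measurable_fst)).aestronglyMeasurable.mul
      (hf.aestronglyMeasurable_div.comp_snd)
  have h2 := this.integral_prod_right'
  refine h2.congr (Eventually.of_forall fun t => ?_)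
  simp only [fractConv, fractConvIntegrand_eq]

theorem memLp_fractConv (hf : StripDecay f) :
    MemLp (fractConv f) 2 (volume.restrict (Ioi (0 : ℝ))) := by
  rw [memLp_two_iff_integrable_sq hf.aestronglyMeasurable_fractConv]
  -- From {y} ≤ 1 and {y} ≤ y, A bounds |f^×(t)| and B bounds t|f^×(t)|, so f^×(t)² ≤ (A² + B²)/(1 +
  -- t²).
  set A := ∫ x in Ioi (0 : ℝ), |f x / x|
  set B := ∫ x in Ioi (0 : ℝ), |f x|
  refine ((integrable_inv_one_add_sq.const_mul (A ^ 2 + B ^ 2)).integrableOn).mono'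
    (hf.aestronglyMeasurable_fractConv.pow 2) ?_
  filter_upwards [ae_restrict_mem measurableSet_Ioi] with t ht
  have h1 := pow_le_pow_left₀ (abs_nonneg _) (hf.abs_fractConv_le t) 2
  have h2 := pow_le_pow_left₀ (abs_nonneg _) (hf.abs_mul_fractConv_le ht) 2
  rw [sq_abs] at h1 h2
  rw [Real.norm_of_nonneg (sq_nonneg _), ← div_eq_mul_inv, le_div_iff₀ (by positivity)]
  nlinarith

end StripDecay

/-- The inversion t ↦ 1/t reflects the strip to 0 < Re s < 1, and scaling by x produces x^s. -/
theorem mellin_complexFract_div {s : ℂ} (h0 : 0 < s.re) (h1 : s.re < 1) {x : ℝ} (hx : 0 < x) :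
    MellinConvergent (fun t => complexFract (x / t)) s ∧
      mellin (fun t => complexFract (x / t)) s = (x : ℂ) ^ s * -(riemannZeta s / s) := by
  have hconv : MellinConvergent (fun t => complexFract t⁻¹) s := by
    have := (MellinConvergent.comp_rpow (f := complexFract) (s := s) (a := -1)
      (by norm_num)).2 (by
        have : s / ((-1 : ℝ) : ℂ) = -s := by push_cast; ring
        rw [this]
        exact mellinConvergent_complexFract (by simpa using h1) (by simpa using h0))
    simpa only [Real.rpow_neg_one] using this
  have heq : (fun t => complexFract (x / t)) = fun t => complexFract (x⁻¹ * t)⁻¹ := by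
    ext t
    rw [mul_inv, inv_inv, div_eq_mul_inv]
  rw [heq]
  refine ⟨(MellinConvergent.comp_mul_left (f := fun t => complexFract t⁻¹) (inv_pos.2 hx)).2 hconv,
    ?_⟩
  rw [mellin_comp_mul_left (fun t => complexFract t⁻¹) s (inv_pos.2 hx), mellin_comp_inv,
    mellin_complexFract h0 h1, smul_eq_mul, Complex.ofReal_inv, Complex.inv_cpow, Complex.cpow_neg,
    inv_inv]
  rw [Complex.arg_ofReal_of_nonneg hx.le]
  exact Real.pi_pos.ne

/-- The integrand of the double integral computing the Mellin transform of `fractConv f`. -/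
noncomputable def fractConvKernel (f : ℝ → ℝ) (s : ℂ) (t x : ℝ) : ℂ :=
  (t : ℂ) ^ (s - 1) * complexFract (x / t) * ((f x / x : ℝ) : ℂ)

/-- As {x/t} ≥ 0, the integral of the norm is itself a Mellin transform, at the real point Re s.
This serves both Fubini and the bound on ζ(s)/s. -/
theorem integral_norm_cpow_mul_fract {s : ℂ} (h0 : 0 < s.re) (h1 : s.re < 1) {x : ℝ}
    (hx : 0 < x) :
    ∫ t in Ioi (0 : ℝ), ‖(t : ℂ) ^ (s - 1) * complexFract (x / t)‖ =
      x ^ s.re * ‖riemannZeta s.re / s.re‖ := by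
  have h := (mellin_complexFract_div (s := (s.re : ℂ)) (by simpa) (by simpa) hx).2
  have h2 : mellin (fun t => complexFract (x / t)) (s.re : ℂ) =
      ((∫ t in Ioi (0 : ℝ), ‖(t : ℂ) ^ (s - 1) * complexFract (x / t)‖ : ℝ) : ℂ) := by
    rw [mellin, ← integral_complex_ofReal]
    refine setIntegral_congr_fun measurableSet_Ioi fun t ht => ?_
    have ht0 : (0 : ℝ) < t := ht
    simp only [smul_eq_mul]
    rw [norm_mul, Complex.norm_cpow_eq_rpow_re_of_pos ht0, complexFract, Complex.norm_real,
      Real.norm_of_nonneg (Int.fract_nonneg _), Complex.ofReal_mul, Complex.ofReal_cpow ht0.le]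
    simp
  have h3 : ‖mellin (fun t => complexFract (x / t)) (s.re : ℂ)‖ =
      ∫ t in Ioi (0 : ℝ), ‖(t : ℂ) ^ (s - 1) * complexFract (x / t)‖ := by
    rw [h2, Complex.norm_real, Real.norm_of_nonneg (integral_nonneg fun _ => norm_nonneg _)]
  rw [← h3, h, norm_mul, norm_neg, Complex.norm_cpow_eq_rpow_re_of_pos hx, Complex.ofReal_re]

theorem integrable_fractConvKernel {f : ℝ → ℝ} (hf : StripDecay f) {s : ℂ} (h0 : 0 < s.re)
    (h1 : s.re < 1) :
    Integrable (Function.uncurry (fractConvKernel f s))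
      ((volume.restrict (Ioi (0 : ℝ))).prod (volume.restrict (Ioi (0 : ℝ)))) := by
  have hm : AEStronglyMeasurable (Function.uncurry (fractConvKernel f s))
      ((volume.restrict (Ioi (0 : ℝ))).prod (volume.restrict (Ioi (0 : ℝ)))) := by
    refine AEStronglyMeasurable.mul (Measurable.aestronglyMeasurable ?_) ?_
    · exact ((Complex.measurable_ofReal.comp measurable_fst).pow_const _).mul
        (measurable_complexFract.comp (measurable_snd.div measurable_fst))
    · exact (Complex.continuous_ofReal.comp_aestronglyMeasurable
        hf.aestronglyMeasurable_div).comp_snd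
  rw [integrable_prod_iff' hm]
  constructor
  · filter_upwards [ae_restrict_mem measurableSet_Ioi] with x hx
    exact Integrable.mul_const (c := ((f x / x : ℝ) : ℂ)) (mellin_complexFract_div h0 h1 hx).1
  -- The inner integral over t is a constant times x^{Re s}, leaving the absolutely convergent
  -- Mellin integral of f.
  · refine ((hf.mellinConvergent h0.le h1.le).norm.const_mul
      ‖riemannZeta s.re / s.re‖).congr ?_
    filter_upwards [ae_restrict_mem measurableSet_Ioi] with x hx
    have hx0 : (0 : ℝ) < x := hx
    simp only [Function.uncurry, fractConvKernel]
    simp_rw [norm_mul _ ((f x / x : ℝ) : ℂ)]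
    rw [integral_mul_const, integral_norm_cpow_mul_fract h0 h1 hx0, norm_smul,
      Complex.norm_cpow_eq_rpow_re_of_pos hx0, Complex.norm_real, Complex.norm_real, norm_div (f x) x,
      Real.norm_of_nonneg hx0.le, Complex.sub_re, Complex.one_re, Real.rpow_sub_one hx0.ne']
    ring

theorem integral_fractConvKernel (f : ℝ → ℝ) (s : ℂ) (t : ℝ) :
    ∫ x in Ioi (0 : ℝ), fractConvKernel f s t x = (t : ℂ) ^ (s - 1) • (fractConv f t : ℂ) := by
  rw [fractConv, ← integral_complex_ofReal, smul_eq_mul, ← integral_const_mul]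
  congr 1 with x
  rw [fractConvKernel, fractConvIntegrand_eq, complexFract, mul_assoc, Complex.ofReal_mul]

theorem mellin_fractConv {f : ℝ → ℝ} (hf : StripDecay f) {s : ℂ} (h0 : 0 < s.re)
    (h1 : s.re < 1) :
    RealMellinConvergent (fractConv f) s ∧
      realMellin (fractConv f) s = -(riemannZeta s / s) * realMellin f s := by
  have hI := integrable_fractConvKernel hf h0 h1
  constructor
  · refine hI.integral_prod_left.congr (Eventually.of_forall fun t => ?_)
    exact integral_fractConvKernel f s t
  · rw [realMellin, mellin]
    simp_rw [← integral_fractConvKernel]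
    rw [integral_integral_swap hI, realMellin, mellin, ← integral_const_mul]
    refine setIntegral_congr_fun measurableSet_Ioi fun x hx => ?_
    have hx0 : (0 : ℝ) < x := hx
    have hxc : (x : ℂ) ≠ 0 := by exact_mod_cast hx0.ne'
    have h := (mellin_complexFract_div h0 h1 hx0).2
    rw [mellin] at h
    simp only [smul_eq_mul] at h
    simp only [fractConvKernel, smul_eq_mul]
    rw [integral_mul_const, h, Complex.cpow_sub _ _ hxc, Complex.cpow_one]
    push_cast
    ring

/-- `ζ(s) / s` is bounded on the critical line. -/
theorem norm_riemannZeta_div_le {s : ℂ} (hs : s.re = 1 / 2) :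
    ‖riemannZeta s / s‖ ≤ ‖riemannZeta (1 / 2) / (1 / 2)‖ := by
  have h0 : 0 < s.re := by rw [hs]; norm_num
  have h1 : s.re < 1 := by rw [hs]; norm_num
  -- Up to sign ζ(s)/s is the transform of {1/t}, whose integral of absolute values depends on Re s
  -- only.
  have hn := integral_norm_cpow_mul_fract h0 h1 one_pos
  have hv := (mellin_complexFract_div h0 h1 one_pos).2
  simp only [Complex.ofReal_one, Complex.one_cpow, one_mul, Real.one_rpow] at hn hv
  rw [hs] at hn
  push_cast at hn
  rw [← norm_neg, ← hv, ← hn]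
  exact norm_integral_le_integral_norm _

/-! ### From density to real approximations of χ -/

theorem hasMellin_chi {s : ℂ} (hs : 0 < s.re) : HasMellin (fun x => (chi x : ℂ)) s (1 / s) := by
  have h := hasMellin_one_Ioc hs
  have hae : (fun t : ℝ => (t : ℂ) ^ (s - 1) • (Ioc (0 : ℝ) 1).indicator (fun _ => (1 : ℂ)) t)
      =ᵐ[volume.restrict (Ioi 0)] fun t => (t : ℂ) ^ (s - 1) • (chi t : ℂ) := by
    have hne : ∀ᵐ x : ℝ ∂volume.restrict (Ioi 0), x ≠ 1 :=
      ae_restrict_of_ae (Measure.ae_ne volume 1)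
    filter_upwards [hne] with x hx
    congr 1
    by_cases hm : x ∈ Ioo (0 : ℝ) 1
    · rw [chi, indicator_of_mem hm, indicator_of_mem (Ioo_subset_Ioc_self hm)]
      simp
    · rw [chi, indicator_of_notMem hm, indicator_of_notMem]
      · simp
      · exact fun h' => hm ⟨h'.1, lt_of_le_of_ne h'.2 hx⟩
  refine ⟨Integrable.congr h.1 hae, ?_⟩
  rw [← h.2, mellin, mellin]
  exact (integral_congr_ae hae).symm

theorem memLp_chi : MemLp chi 2 (volume.restrict (Ioi (0 : ℝ))) := by
  refine (memLp_indicator_const 2 measurableSet_Ioo 1 (Or.inr ?_))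
  exact ((Measure.restrict_apply_le _ _).trans_lt (by simp)).ne

theorem hasMellin_finsetSum {G : ℕ → ℝ → ℂ} {z : ℂ} (hG : ∀ k, MellinConvergent (G k) z)
    (c : ℕ → ℂ) (s : Finset ℕ) :
    HasMellin (fun t => ∑ k ∈ s, c k * G k t) z (∑ k ∈ s, c k * mellin (G k) z) := by
  induction s using Finset.induction_on with
  | empty => simp [HasMellin, MellinConvergent, mellin]
  | insert a s ha ih =>
    simp only [Finset.sum_insert ha]
    have h1 := hasMellin_const_smul (hG a) (c a)
    have h2 := hasMellin_add h1.1 ih.1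
    rw [h1.2, ih.2] at h2
    exact h2

theorem coeFn_sum_smul_toLp {u : ℕ → ℝ → ℂ} (hu : ∀ k, MemLp (u k) 2 volume) (c : ℕ → ℂ)
    (s : Finset ℕ) :
    ((∑ k ∈ s, c k • (hu k).toLp (u k) : Lp ℂ 2 (volume : Measure ℝ)) : ℝ → ℂ) =ᵐ[volume]
      fun t => ∑ k ∈ s, c k * u k t := by
  induction s using Finset.induction_on with
  | empty =>
    simp only [Finset.sum_empty]
    exact Lp.coeFn_zero _ _ _
  | insert a s ha ih =>
    simp only [Finset.sum_insert ha]
    filter_upwards [Lp.coeFn_add (c a • (hu a).toLp (u a)) (∑ k ∈ s, c k • (hu k).toLp (u k)), ih,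
      Lp.coeFn_smul (c a) ((hu a).toLp (u a)), (hu a).coeFn_toLp] with t h1 h2 h3 h4
    rw [h1, Pi.add_apply, h2, h3, Pi.smul_apply, h4, smul_eq_mul]

theorem integral_sq_abs_eq_eLpNorm_sq {h : ℝ → ℝ} {μ : Measure ℝ} (hh : MemLp h 2 μ) :
    ∫ t, |h t| ^ 2 ∂μ = (eLpNorm h 2 μ).toReal ^ 2 := by
  have h0 : 0 ≤ ∫ t, |h t| ^ 2 ∂μ := integral_nonneg fun _ => sq_nonneg _
  rw [hh.eLpNorm_eq_integral_rpow_norm two_ne_zero ENNReal.ofNat_ne_top]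
  simp only [ENNReal.toReal_ofNat, Real.rpow_two, Real.norm_eq_abs]
  rw [ENNReal.toReal_ofReal (Real.rpow_nonneg h0 _), ← Real.rpow_natCast, ← Real.rpow_mul h0]
  norm_num

/-- If `1 / s` is in the closed span of the Mellin transforms of real functions `F k` on the
critical line, then `chi` is an `L²` limit of real linear combinations of the `F k`. -/
theorem exists_real_approximation {F : ℕ → ℝ → ℝ}
    (hF : ∀ k t, MellinConvergent (fun x => (F k x : ℂ)) (criticalPoint t))
    (hF2 : ∀ k, MemLp (F k) 2 (volume.restrict (Ioi (0 : ℝ))))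
    (hu : ∀ k, MemLp (fun t => realMellin (F k) (criticalPoint t)) 2)
    (hdense : (Submodule.span ℂ (range fun k => (hu k).toLp)).topologicalClosure = ⊤)
    {ε : ℝ} (hε : 0 < ε) :
    ∃ (a : ℕ → ℝ) (N : ℕ), ∀ n, N ≤ n →
      ∫ t in Ioi (0 : ℝ), |chi t - ∑ k ∈ Finset.range (n + 1), a k * F k t| ^ 2 < ε := by
  have hre : ∀ t, 0 < (criticalPoint t).re := fun t => by simp
  have hchi2 : MemLp (fun x => (chi x : ℂ)) 2 (volume.restrict (Ioi (0 : ℝ))) := memLp_chi.ofReal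
  have hhalf : criticalPoint 0 = 1 / 2 := by simp [criticalPoint]
  have hX : MemLp (fun t => mellin (fun x => (chi x : ℂ)) (criticalPoint t)) 2 :=
    memLp_mellin_criticalPoint (hhalf ▸ (hasMellin_chi (hre 0)).1) hchi2
  have hmem : hX.toLp ∈ (Submodule.span ℂ (range fun k => (hu k).toLp)).topologicalClosure := by
    rw [hdense]
    trivial
  obtain ⟨v, hv, hdist⟩ := Metric.mem_closure_iff.1 hmem (Real.sqrt ε) (Real.sqrt_pos.2 hε)
  obtain ⟨c, rfl⟩ := Finsupp.mem_span_range_iff_exists_finsupp.1 hv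
  obtain ⟨N, hN⟩ := c.support.exists_nat_subset_range
  -- Since χ and the F k are real, taking real parts of the coefficients replaces f by Re f, which
  -- does not increase the norm. Past N the coefficients vanish.
  refine ⟨fun k => (c k).re, N, fun n hn => ?_⟩
  have hsub : c.support ⊆ Finset.range (n + 1) :=
    hN.trans (Finset.range_subset_range.2 (by omega))
  rw [Finsupp.sum_of_support_subset c hsub _ (by simp)] at hdist
  set s := Finset.range (n + 1)
  set f : ℝ → ℂ := fun x => (chi x : ℂ) - ∑ k ∈ s, c k * (F k x : ℂ) with hf
  have hsum : ∀ t, HasMellin f (criticalPoint t)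
      (mellin (fun x => (chi x : ℂ)) (criticalPoint t) -
        ∑ k ∈ s, c k * realMellin (F k) (criticalPoint t)) := by
    intro t
    have h1 := hasMellin_finsetSum (fun k => hF k t) c s
    have h2 := hasMellin_sub (hasMellin_chi (hre t)).1 h1.1
    rw [h1.2] at h2
    exact h2
  have hf2 : MemLp f 2 (volume.restrict (Ioi (0 : ℝ))) :=
    hchi2.sub (memLp_finsetSum s fun k _ => (hF2 k).ofReal.const_mul (c k))
  have hf1 : MellinConvergent f (1 / 2) := hhalf ▸ (hsum 0).1
  have hnorm : dist hX.toLp (∑ k ∈ s, c k • (hu k).toLp) =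
      (eLpNorm f 2 (volume.restrict (Ioi (0 : ℝ)))).toReal := by
    -- Plancherel turns the distance on the critical line into the norm of f on (0,∞).
    rw [← eLpNorm_mellin_criticalPoint hf1 hf2, dist_eq_norm, Lp.norm_def]
    congr 1
    apply eLpNorm_congr_ae
    filter_upwards [Lp.coeFn_sub hX.toLp (∑ k ∈ s, c k • (hu k).toLp), hX.coeFn_toLp,
      coeFn_sum_smul_toLp hu c s] with t h1 h2 h3
    rw [h1, Pi.sub_apply, h2, h3, (hsum t).2]
  rw [hnorm] at hdist
  have hh2 : MemLp (fun t => chi t - ∑ k ∈ s, (c k).re * F k t) 2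
      (volume.restrict (Ioi (0 : ℝ))) :=
    memLp_chi.sub (memLp_finsetSum s fun k _ => (hF2 k).const_mul _)
  rw [integral_sq_abs_eq_eLpNorm_sq hh2]
  have hle : eLpNorm (fun t => chi t - ∑ k ∈ s, (c k).re * F k t) 2
      (volume.restrict (Ioi (0 : ℝ))) ≤ eLpNorm f 2 (volume.restrict (Ioi (0 : ℝ))) := by
    refine eLpNorm_mono fun t => ?_
    have : chi t - ∑ k ∈ s, (c k).re * F k t = (f t).re := by
      simp [hf, Complex.re_sum]
    rw [this]
    exact Complex.abs_re_le_norm _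
  have hle' := ENNReal.toReal_mono hf2.2.ne hle
  have hlt := lt_of_le_of_lt hle' hdist
  rw [Real.lt_sqrt ENNReal.toReal_nonneg] at hlt
  exact hlt

/-- The approximants depend on ε, whereas gNB wants one choice for each n: take coefficients within
1/(n+1) of the infimum over all choices. -/
theorem verifiesGNB_of_approximation {g : ℕ → ℝ → ℝ}
    (hF2 : ∀ k, MemLp (fractConv (g k)) 2 (volume.restrict (Ioi (0 : ℝ))))
    (h : ∀ ε : ℝ, 0 < ε → ∃ (a : ℕ → ℝ) (N : ℕ), ∀ n, N ≤ n →
      ∫ t in Ioi (0 : ℝ), |chi t - ∑ k ∈ Finset.range (n + 1), a k * fractConv (g k) t| ^ 2 < ε) :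
    VerifiesGNB g := by
  set J : ℕ → (ℕ → ℝ) → ℝ := fun n a =>
    ∫ t in Ioi (0 : ℝ), |chi t - ∑ k ∈ Finset.range (n + 1), a k * fractConv (g k) t| ^ 2
  have hJ0 : ∀ n a, 0 ≤ J n a := fun n a => integral_nonneg fun _ => sq_nonneg _
  have hbdd : ∀ n, BddBelow (range (J n)) := fun n => ⟨0, by rintro _ ⟨a, rfl⟩; exact hJ0 n a⟩
  have hex : ∀ n : ℕ, ∃ a, J n a < (⨅ a, J n a) + 1 / ((n : ℝ) + 1) := fun n =>
    exists_lt_of_ciInf_lt (lt_add_of_pos_right _ (by positivity))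
  choose c hc using hex
  refine ⟨fun k n => c n k, fun n => ?_, ?_⟩
  · exact memLp_chi.sub (memLp_finsetSum _ fun k _ => (hF2 k).const_mul _)
  · rw [Metric.tendsto_atTop]
    intro ε hε
    obtain ⟨a, N, haN⟩ := h (ε / 2) (half_pos hε)
    obtain ⟨M, hM⟩ := exists_nat_one_div_lt (half_pos hε)
    refine ⟨max N M, fun n hn => ?_⟩
    have h1 : J n a < ε / 2 := haN n ((le_max_left _ _).trans hn)
    have h2 : (1 : ℝ) / ((n : ℝ) + 1) ≤ 1 / ((M : ℝ) + 1) := by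
      have : (M : ℝ) ≤ n := by exact_mod_cast (le_max_right _ _).trans hn
      gcongr
    have h3 := ciInf_le (hbdd n) a
    change dist (J n (c n)) 0 < ε
    rw [Real.dist_0_eq_abs, abs_of_nonneg (hJ0 n _)]
    linarith [hc n]

/-! ### Nonvanishing almost everywhere -/

theorem injective_criticalPoint : Function.Injective criticalPoint := by
  intro a b h
  have := congrArg Complex.im h
  simpa [Real.pi_ne_zero] using this

/-- A discrete subset of the Lindelöf space ℂ is countable, so its trace on the line is null. -/
theorem ae_riemannZeta_criticalPoint_ne_zero : ∀ᵐ t, riemannZeta (criticalPoint t) ≠ 0 := by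
  have hd := isDiscrete_iff_discreteTopology.1 isDiscrete_riemannZetaZeros
  have hcount : riemannZetaZeros.Countable := by
    rw [← countable_coe_iff]
    exact countable_of_Lindelof_of_discrete
  have := (hcount.preimage injective_criticalPoint).ae_notMem (volume : Measure ℝ)
  filter_upwards [this] with t ht h
  exact ht h

theorem analyticAt_criticalPoint (t : ℝ) : AnalyticAt ℝ criticalPoint t := by
  have : AnalyticAt ℝ (fun t : ℝ => (t : ℂ)) t := Complex.ofRealCLM.analyticAt t
  unfold criticalPoint
  fun_prop

/-- A holomorphic function on the critical strip which is not identically zero on the critical line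
is nonzero almost everywhere there. -/
theorem ae_ne_zero_of_differentiableAt {F : ℂ → ℂ}
    (hF : ∀ s : ℂ, 0 < s.re → s.re < 1 → DifferentiableAt ℂ F s) {t₀ : ℝ}
    (h0 : F (criticalPoint t₀) ≠ 0) : ∀ᵐ t, F (criticalPoint t) ≠ 0 := by
  have hU : IsOpen {s : ℂ | 0 < s.re ∧ s.re < 1} :=
    (isOpen_lt continuous_const Complex.continuous_re).inter
      (isOpen_lt Complex.continuous_re continuous_const)
  have hA : AnalyticOnNhd ℂ F {s : ℂ | 0 < s.re ∧ s.re < 1} :=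
    DifferentiableOn.analyticOnNhd
      (fun s hs => (hF s hs.1 hs.2).differentiableWithinAt) hU
  -- In the real variable t the function is analytic on the connected line, so nonvanishing at one
  -- point makes its zero set discrete, hence null.
  have hR : AnalyticOnNhd ℝ (F ∘ criticalPoint) univ := fun t _ =>
    ((hA (criticalPoint t) (by simp; norm_num)).restrictScalars (𝕜 := ℝ)).comp
      (analyticAt_criticalPoint t)
  have hcod := hR.preimage_zero_mem_codiscrete (x := t₀) h0
  have hae := ae_restrict_le_codiscreteWithin (μ := (volume : Measure ℝ)) MeasurableSet.univ hcod
  rw [Measure.restrict_univ] at hae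
  filter_upwards [hae] with t ht
  exact ht

/-- Otherwise the pullback has zero Fourier integral, so it vanishes almost everywhere, and
everywhere by continuity. -/
theorem StripDecay.exists_realMellin_criticalPoint_ne_zero {f : ℝ → ℝ} (hf : StripDecay f)
    (h : ∃ x, 0 < x ∧ f x ≠ 0) : ∃ t, realMellin f (criticalPoint t) ≠ 0 := by
  by_contra! hz
  obtain ⟨x, hx, hfx⟩ := h
  have hM := hf.mellinConvergent (s := 1 / 2) (by simp) (by norm_num)
  have h0 := ae_eq_zero_of_fourier_eq_zero (logPullback_integrable hM)
    (memLp_logPullback hM hf.memLp_two.ofReal) fun t => by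
      rw [← mellin_criticalPoint]
      exact hz t
  have hcont : Continuous (logPullback fun x => (f x : ℂ)) := by
    unfold logPullback
    refine Continuous.smul (f := fun u : ℝ => Real.exp (-(1 / 2) * u)) (by fun_prop) ?_
    exact hf.continuousOn_ofReal.comp_continuous (by fun_prop) fun u => Real.exp_pos _
  have h1 := (Continuous.ae_eq_iff_eq volume hcont continuous_const).1 h0
  have h2 := congrFun h1 (-Real.log x)
  rw [logPullback, neg_neg, Real.exp_log hx] at h2
  rcases smul_eq_zero.1 h2 with h3 | h3
  · exact (Real.exp_pos _).ne' h3
  · exact hfx (by exact_mod_cast h3)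

/-! ### The main theorem -/

theorem theorem5 (g : ℕ → ℝ → ℝ) (r : ℕ → ℝ)
    (hsmooth : ContDiffOn ℝ ∞ (g 0) (Ioi (0 : ℝ)))
    (hdecay : ∀ k : ℕ, ∃ α : ℝ, 0 < α ∧
      Tendsto (fun x : ℝ => x ^ ((k : ℝ) - α) * iteratedDeriv k (g 0) x) (𝓝[>] 0) (𝓝 0) ∧
      Tendsto (fun x : ℝ => x ^ ((k : ℝ) + 1 + α) * iteratedDeriv k (g 0) x) atTop (𝓝 0))
    (hrec : ∀ k : ℕ, ∀ x : ℝ, 0 < x → g (k + 1) x = -x * deriv (g k) x - r k * g k x) :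
    (∀ k : ℕ,
      (∀ t : ℝ, 0 < t → IntegrableOn (fractConvIntegrand (g k) t) (Ioi (0 : ℝ))) ∧
      ∀ s : ℂ, 0 < s.re → s.re < 1 →
        RealMellinConvergent (g 0) s ∧
        RealMellinConvergent (fractConv (g k)) s ∧
        realMellin (fractConv (g k)) s =
          -(∏ j ∈ Finset.range k, (s - (r j : ℂ))) * (riemannZeta s / s) * realMellin (g 0) s) ∧
    ((∃ x : ℝ, 0 < x ∧ g 0 x ≠ 0) →
      (∃ δ : ℝ, 0 < δ ∧ ∃ C : ℝ, ∀ t : ℝ,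
        ‖realMellin (g 0) (1 / 2 + (t : ℂ) * Complex.I)‖ ≤ C * Real.exp (-δ * |t|)) →
      VerifiesGNB g) := by
  have hdec : ∀ j, StripDecay (eulerTerm (g 0) j) := fun j =>
    stripDecay_eulerTerm hsmooth j (hdecay j)
  have hg := stripDecay_of_recursion hsmooth hdec hrec
  have hmellin : ∀ k : ℕ, ∀ s : ℂ, 0 < s.re → s.re < 1 → realMellin (fractConv (g k)) s =
      -(∏ j ∈ Finset.range k, (s - (r j : ℂ))) * (riemannZeta s / s) * realMellin (g 0) s := by
    intro k s h0 h1
    rw [(mellin_fractConv (hg k).1 h0 h1).2, realMellin_recursion hg hrec h0 h1.le k]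
    ring
  refine ⟨fun k => ⟨fun t _ => (hg k).1.integrableOn_fractConvIntegrand t, fun s h0 h1 =>
    ⟨(hg 0).1.mellinConvergent h0.le h1.le, (mellin_fractConv (hg k).1 h0 h1).1,
      hmellin k s h0 h1⟩⟩, ?_⟩
  rintro hne ⟨δ, hδ, C, hC⟩
  have hre0 : ∀ t, 0 < (criticalPoint t).re := fun t => by simp
  have hre1 : ∀ t, (criticalPoint t).re < 1 := fun t => by simp; norm_num
  have hhalf : criticalPoint 0 = 1 / 2 := by simp [criticalPoint]
  have hconv : ∀ k t, RealMellinConvergent (fractConv (g k)) (criticalPoint t) := fun k t =>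
    (mellin_fractConv (hg k).1 (hre0 t) (hre1 t)).1
  have hconv0 : ∀ k, RealMellinConvergent (fractConv (g k)) (1 / 2) := fun k =>
    hhalf ▸ hconv k 0
  have hF2 : ∀ k, MemLp (fractConv (g k)) 2 (volume.restrict (Ioi (0 : ℝ))) := fun k =>
    (hg k).1.memLp_fractConv
  have hu : ∀ k, MemLp (fun t => realMellin (fractConv (g k)) (criticalPoint t)) 2 := fun k =>
    memLp_mellin_criticalPoint (hconv0 k) (hF2 k).ofReal
  refine verifiesGNB_of_approximation hF2 fun ε hε =>
    exists_real_approximation hconv hF2 hu ?_ hε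
  have hC0 : 0 ≤ C := by simpa using (norm_nonneg _).trans (hC 0)
  -- Here Z is the transform of g_0^×, sign and ζ factor included. The rate is 2πδ because
  -- `criticalPoint t` has ordinate 2πt, and ζ(s)/s enters the constant through its bound on the
  -- line.
  refine topologicalClosure_span_eq_top (C := ‖riemannZeta (1 / 2) / (1 / 2)‖ * C)
    (b := δ * (2 * Real.pi)) (Z := fun t => realMellin (fractConv (g 0)) (criticalPoint t))
    (by positivity) (continuous_mellin_criticalPoint (hconv0 0)) (fun t => ?_) ?_ r _
    fun k => ?_
  · rw [hmellin 0 _ (hre0 t) (hre1 t), Finset.range_zero, Finset.prod_empty, neg_one_mul, norm_mul,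
      norm_neg, mul_assoc]
    have h1 := hC (2 * Real.pi * t)
    have h2 : (1 / 2 + ((2 * Real.pi * t : ℝ) : ℂ) * Complex.I) = criticalPoint t := by
      simp [criticalPoint]
    rw [h2, abs_mul, abs_of_pos (by positivity : (0 : ℝ) < 2 * Real.pi)] at h1
    gcongr
    · exact norm_riemannZeta_div_le (criticalPoint_re t)
    · refine h1.trans_eq ?_
      congr 2
      ring
  · obtain ⟨t₀, ht₀⟩ := (hg 0).1.exists_realMellin_criticalPoint_ne_zero hne
    have hae := ae_ne_zero_of_differentiableAt
      (fun s h0 h1 => (hg 0).1.differentiableAt_mellin h0.le h1.le) ht₀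
    filter_upwards [hae, ae_riemannZeta_criticalPoint_ne_zero] with t h1 h2
    have h3 : criticalPoint t ≠ 0 := fun h => by
      have := hre0 t
      rw [h] at this
      simp at this
    rw [hmellin 0 _ (hre0 t) (hre1 t)]
    simpa [h2, h3, realMellin] using h1
  · filter_upwards [(hu k).coeFn_toLp] with t ht
    rw [ht, hmellin k _ (hre0 t) (hre1 t), hmellin 0 _ (hre0 t) (hre1 t)]
    simp
    ring
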